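/- Let $d\ge 4$, let $D$ be the square-free part of $(d-3)(d+1)$, $\mathbb K=\mathbb Q(\sqrt D)\subset\mathbb R$, and let $\bar d=d$ if $d$ is odd, $\bar d=2d$ if $d$ is even. Put $\omega=e^{2\pi i/d}$, $\tau=-e^{\pi i/d}$, let $w$ be the cyclic shift $e_j\mapsto e_{j+1}$ of $\mathbb C^d$, $h=\mathrm{diag}(1,\omega,\dots,\omega^{d-1})$, and $\mathbf D_{\mathbf p}=\tau^{p_1p_2}w^{p_1}h^{p_2}$ for $\mathbf p\in\mathbb Z_{\bar d}^2$. A unit vector $\mathbf z\in\mathbb C^d$ is *fiducial* if the $d^2$ points $w^ih^j[\mathbf z]$ of $\mathbb{CP}^{d-1}$ are distinct and mutually equidistant (a SIC-POVM). Let $\Phi_{\mathbf z}(\mathbf p)=\langle \mathbf z,\mathbf D_{\mathbf p}\mathbf z\rangle$ and $S=\{G\in\mathrm{GL}_2\mathbb Z_{\bar d}:\Phi_{\mathbf z}\circ G=\Phi_{\mathbf z}\}$. For $G\in\mathrm{GL}_2\mathbb Z_{\bar d}$, a unitary $U$ is of the form $U_{G,0}$ if $U\mathbf D_{\mathbf p}U^{-1}=\mathbf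 D_{G\mathbf p}$ for all $\mathbf p$. A fiducial $\mathbf z$ is *centred* if $S$ contains an element $F$ of order $3$ and trace $-1$ for which a unitary $U_{F,0}$ exists (a *canonical symmetry*), and every Clifford unitary fixing $[\mathbf z]$ is of the form $U_{G,0}$ for some $G$. Let $\mathbb E_1$ be the extension of $\mathbb K$ generated by the image of $\Phi_{\mathbf z}$, and $\mathbb E$ the extension of $\mathbb K$ generated by $\tau$ and the entries of $\mathbf z\mathbf z^*$. A centred fiducial is *strongly centred* if $\mathbb E=\mathbb E_1(i\sqrt{\bar d})$. Let $\mathcal G$ be the group of automorphisms of $\mathbb E_1$ that preserve the image of $\Phi_{\mathbf z}$ as a set, and $$M=\{G\in\mathrm{GL}_2\mathbb Z_{\bar d}:\ g\circ\Phi_{\mathbf z}=\Phi_{\mathbf z}\circ G\text{ for some }g\in\mathcal G\}.$$ Let $\mathbf z$ be a strongly centred fiducial with canonical symmetry $F$, and assume that $M$ is a maximal abelian subgroup of the centralizer of $S$ in $\mathrm{GL}_2\mathbb Z_{\bar d}$. The fiducial is *type-$z$* if $F$ is conjugate in $\mathrm{GL}_2\mathbb Z_{\bar d}$ to $F_z=\begin{pmatrix}0&-1\\1&-1\end{pmatrix}$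 and *type-$a$* otherwise; a type-$a$ fiducial (for which necessarily $3\mid d$) is *type $a_4$, $a_6$, $a_8$* if the projection $M_3$ of $M$ to $\mathrm{GL}_2\mathbb Z_3$ is isomorphic to $\mathbb Z_2^2$, $\mathbb Z_6$, $\mathbb Z_8$ respectively. Let $u_D$ be the smallest positive power of norm $1$ of a positive fundamental unit of $\mathcal O_{\mathbb K}$, let $r\in\mathbb N$ be such that $u_D^r$ has rational part $(d-1)/2$, and let $\iota=\bar d/d$. The fiducial is *algebraic* if there are a ring homomorphism $j:\mathbb Z_{\bar d}[I,F]\to\mathcal O_{\mathbb K}/(\bar d)$ with $j(F)=[u_D^{\iota r}]$ and a group isomorphism $\hat\jmath:M\to(\mathcal O_{\mathbb K}/(\bar d))^\times$ that extends the homomorphism $j^\times$ induced by $j$ on $\mathbb Z_{\bar d}[I,F]^\times$. Then an algebraic fiducial is of type $$\begin{cases} a_4 & \text{if } 3\mid d \text{ and } D\equiv 1 \pmod 3,\\ a_6 & \text{if } d\equiv 3\pmod{27}\text{ and }3\mid D,\\ a_8 & \text{if } 3\mid d\text{ and } D\equiv 2\pmod 3,\\ z & \text{otherwise.}\end{cases}$$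 -/

import Mathlib

open scoped Matrix NumberField

namespace SIC

/-- `d̄ = d` for odd `d` and `d̄ = 2 d` for even `d`. -/
def dbar (d : ℕ) : ℕ := if Even d then 2 * d else d

/-- `D` is the square-free part of `(d - 3) (d + 1)`. -/
def IsSquarefreePart (d D : ℕ) : Prop :=
  Squarefree D ∧ ∃ f : ℕ, ((d : ℤ) - 3) * ((d : ℤ) + 1) = (f : ℤ) ^ 2 * (D : ℤ)

/-! ### Heisenberg group, fiducial vectors and overlap maps -/

/-- `ω = exp (2 π i / d)`. -/
noncomputable def omega (d : ℕ) : ℂ := Complex.exp (2 * Real.pi * Complex.I / d)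

/-- `τ = - exp (π i / d)`. -/
noncomputable def tau (d : ℕ) : ℂ := -Complex.exp (Real.pi * Complex.I / d)

/-- The cyclic shift `w`, with `(w z)_(j+1) = z_j`. -/
def shift (d : ℕ) : Matrix (ZMod d) (ZMod d) ℂ :=
  Matrix.of fun i j => if i = j + 1 then 1 else 0

/-- The clock matrix `h = diag (1, ω, …, ω ^ (d - 1))`. -/
noncomputable def clock (d : ℕ) : Matrix (ZMod d) (ZMod d) ℂ :=
  Matrix.diagonal fun i => omega d ^ i.val

/-- The operator `D_p = τ ^ (p₁ p₂) w ^ p₁ h ^ p₂` for `p` in `(ℤ/d̄)²`. -/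
noncomputable def disp (d : ℕ) [NeZero d] (p : Fin 2 → ZMod (dbar d)) :
    Matrix (ZMod d) (ZMod d) ℂ :=
  tau d ^ ((p 0).val * (p 1).val) • (shift d ^ (p 0).val * clock d ^ (p 1).val)

/-- The transition probability `|⟨v, w⟩|² / (‖v‖² ‖w‖²)` of the points `[v]`, `[w]` of projective
space. -/
noncomputable def transitionProb {d : ℕ} [NeZero d] (v w : ZMod d → ℂ) : ℝ :=
  ‖star v ⬝ᵥ w‖ ^ 2 / (‖star v ⬝ᵥ v‖ * ‖star w ⬝ᵥ w‖)

/-- `z` has unit norm and the `d²` points `w ^ i h ^ j [z]` are distinct and mutually equidistant,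
that is, they form a SIC-POVM. -/
structure IsFiducial (d : ℕ) [NeZero d] (z : ZMod d → ℂ) : Prop where
  unit_norm : star z ⬝ᵥ z = 1
  equidistant : ∃ l : ℝ, 0 < l ∧ l < 1 ∧ ∀ a b : ZMod d × ZMod d, a ≠ b →
    transitionProb ((shift d ^ a.1.val * clock d ^ a.2.val) *ᵥ z)
      ((shift d ^ b.1.val * clock d ^ b.2.val) *ᵥ z) = l

/-- The overlap map `Φ_z (p) = ⟨z, D_p z⟩`. -/
noncomputable def overlap (d : ℕ) [NeZero d] (z : ZMod d → ℂ) (p : Fin 2 → ZMod (dbar d)) : ℂ :=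
  star z ⬝ᵥ (disp d p *ᵥ z)

/-- `GL₂ (ℤ/d̄)`. -/
abbrev GLd (d : ℕ) : Type := GL (Fin 2) (ZMod (dbar d))

/-- The symmetry group `S` of `Φ_z`: all `G` in `GL₂ (ℤ/d̄)` with `Φ_z ∘ G = Φ_z`. -/
noncomputable def symmetryGroup (d : ℕ) [NeZero d] (z : ZMod d → ℂ) : Subgroup (GLd d) where
  carrier := {G | ∀ p, overlap d z (G.val *ᵥ p) = overlap d z p}
  one_mem' := by intro p; simp
  mul_mem' := by
    intro G H hG hH p
    rw [Units.val_mul, ← Matrix.mulVec_mulVec, hG, hH]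
  inv_mem' := by
    intro G hG p
    rw [← hG, Matrix.mulVec_mulVec, Units.mul_inv, Matrix.one_mulVec]

/-- `U` is a Clifford unitary of the form `U_{F,0}`, that is, it implements `F` without any
displacement: `U D_p U⁻¹ = D_{F p}` for all `p`. -/
def Implements (d : ℕ) [NeZero d] (U : Matrix (ZMod d) (ZMod d) ℂ) (F : GLd d) : Prop :=
  U ∈ Matrix.unitaryGroup (ZMod d) ℂ ∧ ∀ p, U * disp d p * star U = disp d (F.val *ᵥ p)

/-- `U` is in the Clifford group: a unitary matrix whose conjugation action permutes the `D_p` up to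
phases (so that it normalizes the action of `(ℤ/d)²` on projective space). -/
def IsClifford (d : ℕ) [NeZero d] (U : Matrix (ZMod d) (ZMod d) ℂ) : Prop :=
  U ∈ Matrix.unitaryGroup (ZMod d) ℂ ∧ ∀ p, ∃ q, ∃ c : ℂ, U * disp d p * star U = c • disp d q

/-- An element `F` of `S` of order `3` and trace `-1` that corresponds to a Clifford unitary
`U_{F,0}`. -/
structure IsCanonicalSymmetry (d : ℕ) [NeZero d] (z : ZMod d → ℂ) (F : GLd d) : Prop where
  mem : F ∈ symmetryGroup d z
  order : orderOf F = 3
  trace : F.val.trace = -1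
  implemented : ∃ U, Implements d U F

/-- A centred fiducial: `S` contains a canonical element of order `3`, and every Clifford unitary
that fixes `[z]` is displacement-free. -/
structure IsCentred (d : ℕ) [NeZero d] (z : ZMod d → ℂ) : Prop where
  fiducial : IsFiducial d z
  canonical : ∃ F, IsCanonicalSymmetry d z F
  displacement_free : ∀ U, IsClifford d U → (∃ c : ℂ, U *ᵥ z = c • z) → ∃ F, Implements d U F

/-! ### Fields and Galois action -/

/-- The real quadratic field `K = ℚ(√D)`, as a subfield of `ℂ`; its inclusion in `ℂ` is the
embedding for which `√D` is positive. -/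
noncomputable def fieldK (D : ℕ) : IntermediateField ℚ ℂ :=
  IntermediateField.adjoin ℚ {((√(D : ℝ) : ℝ) : ℂ)}

/-- `E₁`, the extension of `K` generated by the values of `Φ_z`. -/
noncomputable def fieldE1 (d D : ℕ) [NeZero d] (z : ZMod d → ℂ) : IntermediateField ℚ ℂ :=
  IntermediateField.adjoin ℚ ({((√(D : ℝ) : ℝ) : ℂ)} ∪ Set.range (overlap d z))

/-- `E`, the extension of `K` generated by `τ` and the entries of the projector `z z*`. -/
noncomputable def fieldE (d D : ℕ) (z : ZMod d → ℂ) : IntermediateField ℚ ℂ :=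
  IntermediateField.adjoin ℚ ({((√(D : ℝ) : ℝ) : ℂ), tau d} ∪
    Set.range fun ij : ZMod d × ZMod d => z ij.1 * star (z ij.2))

/-- A centred fiducial is strongly centred if `E = E₁(i √d̄)`. -/
structure IsStronglyCentred (d D : ℕ) [NeZero d] (z : ZMod d → ℂ) : Prop where
  centred : IsCentred d z
  field_eq : fieldE d D z =
    fieldE1 d D z ⊔ IntermediateField.adjoin ℚ {Complex.I * ((√(dbar d : ℝ) : ℝ) : ℂ)}

/-- `Φ_z` as a map to `E₁`. -/
noncomputable def overlapE1 (d D : ℕ) [NeZero d] (z : ZMod d → ℂ) (p : Fin 2 → ZMod (dbar d)) :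
    fieldE1 d D z :=
  ⟨overlap d z p, IntermediateField.subset_adjoin ℚ _ (Or.inr ⟨p, rfl⟩)⟩

/-- The group `𝒢` of all automorphisms of `E₁` that preserve the image of `Φ_z` as a set. -/
noncomputable def galoisGroup (d D : ℕ) [NeZero d] (z : ZMod d → ℂ) :
    Subgroup (fieldE1 d D z ≃ₐ[ℚ] fieldE1 d D z) where
  carrier := {g | g '' Set.range (overlapE1 d D z) = Set.range (overlapE1 d D z)}
  one_mem' := Set.image_id _
  mul_mem' := by
    intro g h hg hh
    have hcomp : (⇑(g * h) : fieldE1 d D z → fieldE1 d D z) = g ∘ h := rfl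
    change _ '' _ = _ at hg hh ⊢
    rw [hcomp, Set.image_comp, hh, hg]
  inv_mem' := by
    intro g hg
    change _ '' _ = _ at hg ⊢
    conv_lhs => rw [← hg]
    rw [← Set.image_comp]
    have hcomp : (⇑g⁻¹ ∘ ⇑g : fieldE1 d D z → fieldE1 d D z) = id := by
      funext x
      exact g.symm_apply_apply x
    rw [hcomp, Set.image_id]

/-- The group `M` of all `G` in `GL₂ (ℤ/d̄)` with `g ∘ Φ_z = Φ_z ∘ G` for some `g` in `𝒢`, that is,
the union of the cosets `G_g S`. -/
noncomputable def groupM (d D : ℕ) [NeZero d] (z : ZMod d → ℂ) : Subgroup (GLd d) where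
  carrier := {G | ∃ g ∈ galoisGroup d D z, ∀ p,
    g (overlapE1 d D z p) = overlapE1 d D z (G.val *ᵥ p)}
  one_mem' := ⟨1, one_mem _, by intro p; simp⟩
  mul_mem' := by
    rintro G H ⟨g, hg, hG⟩ ⟨h, hh, hH⟩
    refine ⟨g * h, mul_mem hg hh, fun p => ?_⟩
    rw [AlgEquiv.mul_apply, hH, hG, Units.val_mul, Matrix.mulVec_mulVec]
  inv_mem' := by
    rintro G ⟨g, hg, hG⟩
    refine ⟨g⁻¹, inv_mem hg, fun p => ?_⟩
    have h := hG ((G⁻¹).val *ᵥ p)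
    rw [Matrix.mulVec_mulVec, Units.mul_inv, Matrix.one_mulVec] at h
    rw [← h]
    exact g.symm_apply_apply _

/-- `M` is a maximal abelian subgroup of `H`. -/
def IsMaximalAbelianIn {G : Type*} [Group G] (M H : Subgroup G) : Prop :=
  Maximal (fun A : Subgroup G => A ≤ H ∧ ∀ a ∈ A, ∀ b ∈ A, a * b = b * a) M

/-! ### Algebraic fiducials -/

/-- `𝓞_K / (d̄)`. -/
abbrev quotO (d D : ℕ) : Type :=
  𝓞 (fieldK D) ⧸ Ideal.span {((dbar d : ℕ) : 𝓞 (fieldK D))}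

/-- `u` is a fundamental unit of `𝓞_K`, positive for the embedding with `√D > 0`. -/
def IsPosFundamentalUnit (D : ℕ) (u : (𝓞 (fieldK D))ˣ) : Prop :=
  (∀ v : (𝓞 (fieldK D))ˣ, ∃ n : ℤ, v = u ^ n ∨ v = -u ^ n) ∧
    0 < (((u : 𝓞 (fieldK D)) : fieldK D) : ℂ).re

/-- `u` is the smallest power `u_D` with norm `1` of a positive fundamental unit. -/
def IsUnitD (D : ℕ) (u : (𝓞 (fieldK D))ˣ) : Prop :=
  ∃ uf : (𝓞 (fieldK D))ˣ, IsPosFundamentalUnit D uf ∧ ∃ k : ℕ,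
    IsLeast {k : ℕ | 0 < k ∧
      Algebra.norm ℚ (((uf ^ k : (𝓞 (fieldK D))ˣ) : 𝓞 (fieldK D)) : fieldK D) = 1} k ∧
    u = uf ^ k

/-- The rational part of `u` is `(d - 1) / 2`. -/
def HasRationalPart (d D : ℕ) (u : (𝓞 (fieldK D))ˣ) : Prop :=
  ∃ b : ℚ, (((u : 𝓞 (fieldK D)) : fieldK D) : ℂ) =
    ((d : ℂ) - 1) / 2 + (b : ℂ) * ((√(D : ℝ) : ℝ) : ℂ)

/-- `z` is algebraic, with respect to the canonical symmetry `F`: with `u = u_D ^ r` of rational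
part `(d - 1) / 2` and `ι = d̄ / d`, there is a ring homomorphism `j : (ℤ/d̄)[I, F] → 𝓞_K / (d̄)`
with `j F = [u ^ ι]`, and the homomorphism which it induces on invertible elements extends to a
group isomorphism `M ≅ (𝓞_K / (d̄))ˣ`. -/
def IsAlgebraicFiducial (d D : ℕ) [NeZero d] (z : ZMod d → ℂ) (F : GLd d) : Prop :=
  ∃ (uD : (𝓞 (fieldK D))ˣ) (r : ℕ), IsUnitD D uD ∧ HasRationalPart d D (uD ^ r) ∧
  ∃ j : Algebra.adjoin (ZMod (dbar d)) {F.val} →+* quotO d D,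
    j ⟨F.val, Algebra.self_mem_adjoin_singleton _ _⟩ =
      Ideal.Quotient.mk _ ((uD ^ (dbar d / d * r) : (𝓞 (fieldK D))ˣ) : 𝓞 (fieldK D)) ∧
  ∃ jhat : groupM d D z ≃* (quotO d D)ˣ,
    ∀ (m : groupM d D z) (hm : (m : GLd d).val ∈ Algebra.adjoin (ZMod (dbar d)) {F.val}),
      ((jhat m : (quotO d D)ˣ) : quotO d D) = j ⟨(m : GLd d).val, hm⟩

/-! ### Types -/

/-- Zauner's matrix `F_z`. -/
def zauner (d : ℕ) : GLd d where
  val := !![0, -1; 1, -1]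
  inv := !![-1, 1; -1, 0]
  val_inv := by ext i j; fin_cases i <;> fin_cases j <;> simp [Matrix.mul_apply]
  inv_val := by ext i j; fin_cases i <;> fin_cases j <;> simp [Matrix.mul_apply]

/-- Type `z`: `F` is conjugate to `F_z` in `GL₂ (ℤ/d̄)`. -/
def IsTypeZ (d : ℕ) (F : GLd d) : Prop := IsConj F (zauner d)

/-- Type `a`, with `M₃`, the projection of `M` to `GL₂ (ℤ/3)`, isomorphic to `A`. -/
def IsTypeAWith (d D : ℕ) [NeZero d] (z : ZMod d → ℂ) (F : GLd d) (A : Type) [Group A] : Prop :=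
  ¬ IsTypeZ d F ∧ ∃ h : 3 ∣ dbar d,
    Nonempty ((groupM d D z).map
      (Matrix.GeneralLinearGroup.map (n := Fin 2) (ZMod.castHom h (ZMod 3))) ≃* A)

/-- Type `a₄`: type `a` with `M₃ ≅ (ℤ/2)²`. -/
def IsTypeA4 (d D : ℕ) [NeZero d] (z : ZMod d → ℂ) (F : GLd d) : Prop :=
  IsTypeAWith d D z F (Multiplicative (ZMod 2 × ZMod 2))

/-- Type `a₆`: type `a` with `M₃ ≅ ℤ/6`. -/
def IsTypeA6 (d D : ℕ) [NeZero d] (z : ZMod d → ℂ) (F : GLd d) : Prop :=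
  IsTypeAWith d D z F (Multiplicative (ZMod 6))

/-- Type `a₈`: type `a` with `M₃ ≅ ℤ/8`. -/
def IsTypeA8 (d D : ℕ) [NeZero d] (z : ZMod d → ℂ) (F : GLd d) : Prop :=
  IsTypeAWith d D z F (Multiplicative (ZMod 8))

end SIC

/-! Write `N` for `d̄`, `O` for the ring of integers of `K`, `u = u_D ^ r` and `v = u ^ ι`, so that
`j F = [v]`. Both `F` and `v` are roots of `X² + X + 1` modulo `N`, a polynomial of discriminant
`-3`. Hence three times any element of `O` lies in `ℤ[v] + N O`, and three times any matrix
commuting with `F` lies in `(ℤ/N)[F]`: away from `3`, everything is governed by `j`.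

Each type-`a` condition forces `d ≡ 3` modulo `9`, so `N = 3 m` with `m` prime to `3`. The
surjections `M → M₃` and `M ≅ (O/N)ˣ → (O/3)ˣ` then have the same kernel (`map_eq_one_iff_exists`),
because an element of either kernel differs from `1` only away from `3`, where `jhat` is given by
`j`. So `M₃` is the unit group of `O/3 = 𝔽₃[√D]`, which depends only on `D` modulo `3`. Moreover `(d
- 3) (d + 1) = f² D` with `3 ∣ f`, which gives `u ≡ 1` modulo `3`; this pulls back to `F ≡ 1` modulo
`3` (`map_eq_one_of_three_dvd`) and excludes type `z`.

Conversely `F`, of trace `-1` and determinant `1`, is conjugate to Zauner's matrix unless `F ≡ 1`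
modulo `3` (`exists_conj_or_three`). In that case `v ≡ 1` modulo `3`, the norm of `v - 1` is
divisible by `9`, so `d ≡ 3` modulo `9`; if `3 ∣ D`, square-freeness improves this to `27`. One of
the type-`a` conditions therefore holds. -/

namespace SIC

/-! ### Quadratic orders: the index of `ℤ[v]` modulo `N`. -/

section QuadraticOrder

variable {O : Type*} [CommRing O] [CharZero O] {σ : O →+* O}

/-- Taking norms turns the divisibility into `N² ∣ c²` in `ℤ`. -/
theorem int_dvd_of_cast_dvd (hn : ∀ x, ∃ n : ℤ, x * σ x = n) {N c : ℤ} (h : (N : O) ∣ c) :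
    N ∣ c := by
  obtain ⟨β, hβ⟩ := h
  obtain ⟨n, hn⟩ := hn β
  have h2 : σ (c : O) = N * σ β := by rw [hβ]; simp
  rw [map_intCast] at h2
  have h3 : ((c ^ 2 : ℤ) : O) = ((N ^ 2 * n : ℤ) : O) := by
    push_cast
    rw [← hn]
    linear_combination (c : O) * h2 + (N : O) * σ β * hβ
  exact (Int.pow_dvd_pow_iff two_ne_zero).1 ⟨n, Int.cast_injective h3⟩

/-- Multiplying `v² + v + 1` by `σ v = v⁻¹` gives `t + 1`. -/
theorem dvd_trace_add_one (hn : ∀ x, ∃ n : ℤ, x * σ x = n) {N t : ℤ} {v : O}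
    (hv : v * σ v = 1) (ht : v + σ v = t) (h : (N : O) ∣ v ^ 2 + v + 1) : N ∣ t + 1 := by
  apply int_dvd_of_cast_dvd hn
  have : (((t + 1 : ℤ)) : O) = (v ^ 2 + v + 1) * σ v := by
    push_cast
    linear_combination (-v - 1) * hv - ht
  rw [this]
  exact h.mul_right _

/-- Modulo `N`, three times any element is in `ℤ[v]`. -/
theorem exists_three_mul_sub (htr : ∀ x, ∃ t : ℤ, x + σ x = t) {N t : ℤ} {v : O}
    (hv : v * σ v = 1) (ht : v + σ v = t) (h : N ∣ t + 1) (α : O) :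
    ∃ A B : ℤ, (N : O) ∣ 3 * α - (A + B * v) := by
  have hσσ : σ (σ v) = v := by
    have h1 := congrArg σ ht
    rw [map_add, map_intCast, ← ht] at h1
    linear_combination h1
  obtain ⟨p, hp⟩ := htr (α * v)
  obtain ⟨q, hq⟩ := htr (α * σ v)
  obtain ⟨r, hr⟩ := htr (α * σ v ^ 2)
  obtain ⟨s, hs⟩ := htr α
  obtain ⟨k, hk⟩ := h
  simp only [map_mul, map_pow, hσσ] at hp hq hr
  -- Cramer's rule: for `α = a + b v` with integers `a`, `b`, these two integers are `-(v - σ v)²`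
  -- times `a` and `b`, and `(v - σ v)² = t² - 4 ≡ -3` modulo `N`.
  refine ⟨s - r, q - p, k * (t - 1) * α, ?_⟩
  have hk' : (t : O) + 1 = N * k := by exact_mod_cast hk
  push_cast
  rw [← hp, ← hq, ← hr, ← hs]
  linear_combination (t - 1) * α * hk' + α * (v + σ v + t) * ht + (σ α - 3 * α) * hv

/-- Eliminating between the relation and its conjugate multiplies `a` and `b` by `t² - 4`, which is
`-3` modulo `N`. -/
theorem dvd_three_mul_of_dvd (hn : ∀ x, ∃ n : ℤ, x * σ x = n) {N t : ℤ} {v : O}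
    (hv : v * σ v = 1) (ht : v + σ v = t) (h : N ∣ t + 1) {a b : ℤ} (hab : (N : O) ∣ a + b * v) :
    N ∣ 3 * a ∧ N ∣ 3 * b := by
  have hdisc : (v - σ v) ^ 2 = (t : O) ^ 2 - 4 := by
    rw [← ht]; linear_combination (-4) * hv
  obtain ⟨β, hβ⟩ := hab
  have hβ' := congrArg σ hβ
  simp only [map_mul, map_add, map_intCast] at hβ'
  have key : ∀ c : ℤ, N ∣ (t ^ 2 - 4) * c → N ∣ 3 * c := by
    intro c hc
    have : 3 * c = (t + 1) * ((t - 1) * c) - (t ^ 2 - 4) * c := by ring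
    rw [this]
    exact dvd_sub (h.mul_right _) hc
  refine ⟨key a ?_, key b ?_⟩ <;> apply int_dvd_of_cast_dvd hn <;> push_cast <;> rw [← hdisc]
  · refine ⟨(β * σ v - σ β * v) * (σ v - v), ?_⟩
    linear_combination (σ v - v) * σ v * hβ - (σ v - v) * v * hβ'
  · refine ⟨(β - σ β) * (v - σ v), ?_⟩
    linear_combination (v - σ v) * hβ - (v - σ v) * hβ'

/-- `2 - t` is the norm of `v - 1`. -/
theorem nine_dvd_trace_sub_two (hn : ∀ x, ∃ n : ℤ, x * σ x = n) {t : ℤ} {v : O}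
    (hv : v * σ v = 1) (ht : v + σ v = t) (h : (3 : O) ∣ v - 1) : (9 : ℤ) ∣ t - 2 := by
  obtain ⟨β, hβ⟩ := h
  obtain ⟨n, hn⟩ := hn β
  have hβ' := congrArg σ hβ
  simp only [map_mul, map_sub, map_one, map_ofNat] at hβ'
  refine ⟨-n, Int.cast_injective (α := O) ?_⟩
  push_cast
  rw [← ht, ← hn]
  linear_combination hv - (σ v - 1) * hβ - 3 * β * hβ'

end QuadraticOrder

/-! ### Two-by-two matrices of trace `-1` and determinant `1`. -/

section TwoByTwo

variable {R : Type*} [CommRing R] {F : Matrix (Fin 2) (Fin 2) R}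

theorem sq_add_self_add_one (htr : F.trace = -1) (hdet : F.det = 1) : F * F + F + 1 = 0 := by
  rw [Matrix.trace_fin_two] at htr
  rw [Matrix.det_fin_two] at hdet
  ext i j
  fin_cases i <;> fin_cases j <;> simp [Matrix.mul_apply, Fin.sum_univ_two]
  · linear_combination F 0 0 * htr - hdet
  · linear_combination F 0 1 * htr
  · linear_combination F 1 0 * htr
  · linear_combination F 1 1 * htr - hdet

/-- For `G = a + b F` the coefficients `3 a` and `3 b` are combinations of the traces of `G` and `G
F`; the same combinations work for every `G` in the centralizer. -/
theorem exists_three_smul_eq (htr : F.trace = -1) (hdet : F.det = 1)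
    {G : Matrix (Fin 2) (Fin 2) R} (h : G * F = F * G) :
    ∃ x y : R, (3 : R) • G = x • (1 : Matrix (Fin 2) (Fin 2) R) + y • F := by
  rw [Matrix.trace_fin_two] at htr
  rw [Matrix.det_fin_two] at hdet
  have h00 := congrFun (congrFun h 0) 0
  have h01 := congrFun (congrFun h 0) 1
  have h10 := congrFun (congrFun h 1) 0
  simp only [Matrix.mul_apply, Fin.sum_univ_two] at h00 h01 h10
  have h11 : F 1 1 = -1 - F 0 0 := by linear_combination htr
  rw [h11] at h01 h10 hdet
  refine ⟨(G 0 0 + G 1 1) - (G * F).trace, - (2 * (G * F).trace + (G 0 0 + G 1 1)), ?_⟩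
  ext i j
  fin_cases i <;> fin_cases j <;> simp [Matrix.trace_fin_two, Matrix.mul_apply, Fin.sum_univ_two]
    <;> rw [h11]
  · linear_combination (-2 * (G 0 0 - G 1 1)) * hdet - 2 * F 1 0 * h01 - (1 + 2 * F 0 0) * h00
  · linear_combination (2 * F 0 0 + 1) * h01 - 2 * F 0 1 * h00 - 4 * G 0 1 * hdet
  · linear_combination -(2 * F 0 0 + 1) * h10 + 2 * F 1 0 * h00 - 4 * G 1 0 * hdet
  · linear_combination (2 * (G 0 0 - G 1 1)) * hdet + 2 * F 1 0 * h01 + (1 + 2 * F 0 0) * h00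

theorem mem_adjoin_singleton_iff (htr : F.trace = -1) (hdet : F.det = 1)
    {G : Matrix (Fin 2) (Fin 2) R} :
    G ∈ Algebra.adjoin R {F} ↔ ∃ x y : R, G = x • (1 : Matrix (Fin 2) (Fin 2) R) + y • F := by
  constructor
  · intro h
    induction h using Algebra.adjoin_induction with
    | mem x hx => exact ⟨0, 1, by rw [Set.mem_singleton_iff.1 hx]; simp⟩
    | algebraMap r => exact ⟨r, 0, by rw [Algebra.algebraMap_eq_smul_one]; simp⟩
    | add p q _ _ hp hq =>
      obtain ⟨a, b, rfl⟩ := hp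
      obtain ⟨c, e, rfl⟩ := hq
      exact ⟨a + c, b + e, by module⟩
    | mul p q _ _ hp hq =>
      obtain ⟨a, b, rfl⟩ := hp
      obtain ⟨c, e, rfl⟩ := hq
      refine ⟨a * c - b * e, a * e + b * c - b * e, ?_⟩
      have hF' : F * F = -1 - F := by
        rw [eq_sub_iff_add_eq, ← sub_eq_zero, sub_neg_eq_add]
        exact sq_add_self_add_one htr hdet
      simp only [add_mul, mul_add, smul_mul_smul_comm, one_mul, mul_one, hF']
      module
  · rintro ⟨x, y, rfl⟩
    exact add_mem (Subalgebra.smul_mem _ (one_mem _) _)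
      (Subalgebra.smul_mem _ (Algebra.self_mem_adjoin_singleton _ _) _)

theorem isUnit_of_forall_prime_castHom_ne_zero {N : ℕ} [NeZero N] {z : ZMod N}
    (h : ∀ (p : ℕ) (hp : p ∣ N), p.Prime → ZMod.castHom hp (ZMod p) z ≠ 0) : IsUnit z := by
  rw [← ZMod.natCast_zmod_val z, ZMod.isUnit_iff_coprime]
  refine Nat.coprime_of_dvd fun p hp hpz hpN => h p hpN hp ?_
  rw [← ZMod.natCast_zmod_val z, map_natCast]
  exact (ZMod.natCast_eq_zero_iff _ _).2 hpz

/-- A binary quadratic form over `ℤ/N` that is nonzero modulo each prime factor of `N` represents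
a unit. -/
theorem exists_isUnit_form {N : ℕ} [NeZero N] {a b c : ZMod N}
    (h : ∀ (p : ℕ) (hp : p ∣ N), p.Prime → ¬ (ZMod.castHom hp (ZMod p) a = 0 ∧
      ZMod.castHom hp (ZMod p) b = 0 ∧ ZMod.castHom hp (ZMod p) c = 0)) :
    ∃ x y : ZMod N, IsUnit (a * x ^ 2 + b * x * y + c * y ^ 2) := by
  -- Modulo a single prime one of `(1, 0)`, `(0, 1)`, `(1, 1)` works; the Chinese remainder theorem
  -- glues the choices.
  have hloc : ∀ p : ℕ, ∃ x y : ℕ, ∀ hp : p ∣ N, p.Prime →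
      ZMod.castHom hp (ZMod p) (a * (x : ZMod N) ^ 2 + b * x * y + c * (y : ZMod N) ^ 2) ≠ 0 := by
    intro p
    by_cases hp : p ∣ N ∧ p.Prime
    · obtain ⟨hp, hpp⟩ := hp
      by_cases ha : ZMod.castHom hp (ZMod p) a = 0
      · by_cases hc : ZMod.castHom hp (ZMod p) c = 0
        · refine ⟨1, 1, fun _ _ h0 => h p hp hpp ⟨ha, ?_, hc⟩⟩
          simpa [-ZMod.castHom_apply, ha, hc] using h0
        · exact ⟨0, 1, fun _ _ h0 => hc (by simpa [-ZMod.castHom_apply] using h0)⟩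
      · exact ⟨1, 0, fun _ _ h0 => ha (by simpa [-ZMod.castHom_apply] using h0)⟩
    · exact ⟨0, 0, fun h1 h2 => (hp ⟨h1, h2⟩).elim⟩
  choose x y hxy using hloc
  have hne : ∀ p ∈ N.primeFactors, p ≠ 0 := fun p hp => (Nat.prime_of_mem_primeFactors hp).ne_zero
  have hco : Set.Pairwise (N.primeFactors : Set ℕ) (Function.onFun Nat.Coprime fun p => p) :=
    fun p hp q hq hpq => (Nat.coprime_primes (Nat.prime_of_mem_primeFactors hp)
      (Nat.prime_of_mem_primeFactors hq)).2 hpq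
  obtain ⟨X, hX⟩ := Nat.chineseRemainderOfFinset x (fun p => p) N.primeFactors hne hco
  obtain ⟨Y, hY⟩ := Nat.chineseRemainderOfFinset y (fun p => p) N.primeFactors hne hco
  refine ⟨X, Y, isUnit_of_forall_prime_castHom_ne_zero fun p hp hpp => ?_⟩
  have hmem : p ∈ N.primeFactors := Nat.mem_primeFactors.2 ⟨hpp, hp, NeZero.ne N⟩
  have h1 := (ZMod.natCast_eq_natCast_iff _ _ _).2 (hX p hmem)
  have h2 := (ZMod.natCast_eq_natCast_iff _ _ _).2 (hY p hmem)
  have h3 := hxy p hp hpp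
  simpa only [map_add, map_mul, map_pow, map_natCast, h1, h2] using h3

/-- Over `ℤ/N`, a matrix of trace `-1` and determinant `1` is conjugate to Zauner's matrix unless
it is trivial modulo `3`. -/
theorem exists_conj_or_three {N : ℕ} [NeZero N] {F : GL (Fin 2) (ZMod N)}
    (htr : F.val.trace = -1) (hdet : F.val.det = 1) :
    (∃ P : GL (Fin 2) (ZMod N), F.val * P.val = P.val * !![0, -1; 1, -1]) ∨
      ∃ h : 3 ∣ N, Matrix.GeneralLinearGroup.map (n := Fin 2) (ZMod.castHom h (ZMod 3)) F = 1 := by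
  rw [Matrix.trace_fin_two] at htr
  rw [Matrix.det_fin_two] at hdet
  -- These are the coefficients of the form `ξ ↦ det (ξ, F ξ)`, which vanishes modulo `p` exactly
  -- when `F` is scalar modulo `p`.
  by_cases h : ∀ (p : ℕ) (hp : p ∣ N), p.Prime → ¬ (ZMod.castHom hp (ZMod p) (F.val 1 0) = 0 ∧
      ZMod.castHom hp (ZMod p) (F.val 1 1 - F.val 0 0) = 0 ∧
      ZMod.castHom hp (ZMod p) (- F.val 0 1) = 0)
  · left
    obtain ⟨x, y, hxy⟩ := exists_isUnit_form h
    -- In the basis `ξ, F ξ` the matrix `F` becomes the companion matrix, since `F² ξ = -ξ - F ξ`.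
    refine ⟨Matrix.GeneralLinearGroup.mk'' !![x, F.val 0 0 * x + F.val 0 1 * y;
      y, F.val 1 0 * x + F.val 1 1 * y] ?_, ?_⟩
    · convert hxy using 1
      rw [Matrix.det_fin_two_of]
      ring
    · change F.val * !![x, F.val 0 0 * x + F.val 0 1 * y; y, F.val 1 0 * x + F.val 1 1 * y] =
        !![x, F.val 0 0 * x + F.val 0 1 * y; y, F.val 1 0 * x + F.val 1 1 * y] * _
      ext i j
      fin_cases i <;> fin_cases j <;> simp [Matrix.mul_apply, Fin.sum_univ_two]
      · linear_combination (F.val 0 0 * x + F.val 0 1 * y) * htr - x * hdet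
      · linear_combination (F.val 1 0 * x + F.val 1 1 * y) * htr - y * hdet
  · right
    push Not at h
    obtain ⟨p, hp, hpp, h10, h11, h01⟩ := h
    have := Fact.mk hpp
    have htr' := congrArg (ZMod.castHom hp (ZMod p)) htr
    have hdet' := congrArg (ZMod.castHom hp (ZMod p)) hdet
    simp only [map_add, map_sub, map_mul, map_neg, map_one] at htr' hdet' h11 h01
    set φ := ZMod.castHom hp (ZMod p) with hφ
    have h01 : φ (F.val 0 1) = 0 := neg_eq_zero.1 h01
    have h11 : φ (F.val 1 1) = φ (F.val 0 0) := sub_eq_zero.1 h11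
    rw [h11] at htr' hdet'
    rw [h01, zero_mul] at hdet'
    -- A scalar `c` has `2 c = -1` and `c² = 1`, so `4 = 1` modulo `p`.
    have h3 : ((3 : ℕ) : ZMod p) = 0 := by
      push_cast
      linear_combination (2 * φ (F.val 0 0) - 1) * htr' - 4 * hdet'
    have hp3 : p = 3 :=
      (Nat.prime_dvd_prime_iff_eq hpp Nat.prime_three).1 ((ZMod.natCast_eq_zero_iff _ _).1 h3)
    subst hp3
    have h00 : φ (F.val 0 0) = 1 := by
      linear_combination htr' * 2 - φ (F.val 0 0) * h3 - h3
    refine ⟨hp, ?_⟩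
    ext i j
    fin_cases i <;> fin_cases j
    · exact h00
    · exact h01
    · exact h10
    · exact h11.trans h00

theorem map_ne_one_of_conj {N : ℕ} (h : 3 ∣ N) {F P : GL (Fin 2) (ZMod N)}
    (hP : F.val * P.val = P.val * !![0, -1; 1, -1]) :
    Matrix.GeneralLinearGroup.map (n := Fin 2) (ZMod.castHom h (ZMod 3)) F ≠ 1 := by
  intro h1
  have hZ : P⁻¹.val * (F.val * P.val) = !![0, -1; 1, -1] := by
    rw [hP, ← mul_assoc, Units.inv_mul, one_mul]
  have h2 : Matrix.GeneralLinearGroup.map (n := Fin 2) (ZMod.castHom h (ZMod 3))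
      (P⁻¹ * (F * P)) = 1 := by
    rw [map_mul, map_mul, h1, one_mul, ← map_mul, inv_mul_cancel, map_one]
  have h3 : ZMod.castHom h (ZMod 3) ((P⁻¹.val * (F.val * P.val)) 0 0) = 1 :=
    congrArg (fun G : GL (Fin 2) (ZMod 3) => G.val 0 0) h2
  rw [hZ] at h3
  simp at h3

end TwoByTwo

/-! ### Comparison of the reductions modulo `3` of `M` and of `(O/N)ˣ`. -/

section KernelComparison

variable {N : ℕ}

/-- `m l` is the idempotent of `ℤ/N` that is `1` modulo `3` and `0` modulo `m`. It turns reduction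
modulo `3` into a multiplication, which makes sense in every `ℤ/N`-module. -/
theorem castHom_eq_zero_iff {m : ℕ} {k l : ℤ} (hN : N = 3 * m) (hm : m ≠ 0)
    (hkl : 3 * k + m * l = 1) (h3 : 3 ∣ N) (x : ZMod N) :
    ZMod.castHom h3 (ZMod 3) x = 0 ↔ (((m * l : ℤ)) : ZMod N) * x = 0 := by
  obtain ⟨n, rfl⟩ := ZMod.intCast_surjective x
  rw [map_intCast, ← Int.cast_mul, ZMod.intCast_zmod_eq_zero_iff_dvd,
    ZMod.intCast_zmod_eq_zero_iff_dvd]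
  subst hN
  push_cast
  constructor
  · rintro ⟨c, rfl⟩
    exact ⟨l * c, by ring⟩
  · rintro ⟨c, hc⟩
    have hc' : l * n = 3 * c := by
      apply mul_left_cancel₀ (Nat.cast_ne_zero.2 hm : (m : ℤ) ≠ 0)
      linear_combination hc
    exact ⟨k * n + m * c, by linear_combination (-n) * hkl + m * hc'⟩

theorem map_eq_one_iff {m : ℕ} {k l : ℤ} (hN : N = 3 * m) (hm : m ≠ 0)
    (hkl : 3 * k + m * l = 1) (h3 : 3 ∣ N) (G : GL (Fin 2) (ZMod N)) :
    Matrix.GeneralLinearGroup.map (n := Fin 2) (ZMod.castHom h3 (ZMod 3)) G = 1 ↔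
      (m * l : ℤ) • (G.val - 1) = 0 := by
  have key : Matrix.GeneralLinearGroup.map (n := Fin 2) (ZMod.castHom h3 (ZMod 3)) G = 1 ↔
      ∀ i j, ZMod.castHom h3 (ZMod 3) ((G.val - 1) i j) = 0 := by
    rw [Matrix.GeneralLinearGroup.ext_iff]
    refine forall_congr' fun i => forall_congr' fun j => ?_
    rw [Matrix.sub_apply, map_sub, sub_eq_zero]
    have : (ZMod.castHom h3 (ZMod 3)) ((1 : Matrix (Fin 2) (Fin 2) (ZMod N)) i j) =
        (1 : Matrix (Fin 2) (Fin 2) (ZMod 3)) i j := by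
      rw [Matrix.one_apply, Matrix.one_apply]
      split_ifs
      · exact map_one _
      · exact map_zero _
    rw [this]
    rfl
  rw [key, ← Matrix.ext_iff]
  refine forall_congr' fun i => forall_congr' fun j => ?_
  rw [castHom_eq_zero_iff hN hm hkl h3, Matrix.smul_apply, Matrix.zero_apply, zsmul_eq_mul]

variable {O : Type*} [CommRing O] {F : GL (Fin 2) (ZMod N)} {v : O}
  {j : Algebra.adjoin (ZMod N) {F.val} →+* O ⧸ Ideal.span {(N : O)}}

theorem dvd_sq_add_self_add_one (htr : F.val.trace = -1) (hdet : F.val.det = 1)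
    (hj : j ⟨F.val, Algebra.self_mem_adjoin_singleton _ _⟩ = Ideal.Quotient.mk _ v) :
    (N : O) ∣ v ^ 2 + v + 1 := by
  rw [← Ideal.mem_span_singleton, ← Ideal.Quotient.eq_zero_iff_mem, map_add, map_add, map_pow,
    map_one, ← hj, ← map_pow, ← map_add, ← map_one j, ← map_add]
  rw [← map_zero j]
  congr 1
  apply Subtype.ext
  change F.val ^ 2 + F.val + 1 = 0
  rw [pow_two]
  exact sq_add_self_add_one htr hdet

theorem exists_eq_zsmul (htr : F.val.trace = -1) (hdet : F.val.det = 1)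
    (x : Algebra.adjoin (ZMod N) {F.val}) : ∃ a b : ℤ,
      x = a • (1 : Algebra.adjoin (ZMod N) {F.val}) +
        b • ⟨F.val, Algebra.self_mem_adjoin_singleton _ _⟩ := by
  obtain ⟨a, b, h⟩ := (mem_adjoin_singleton_iff htr hdet).1 x.2
  obtain ⟨a, rfl⟩ := ZMod.intCast_surjective a
  obtain ⟨b, rfl⟩ := ZMod.intCast_surjective b
  refine ⟨a, b, Subtype.ext ?_⟩
  rw [h, Int.cast_smul_eq_zsmul, Int.cast_smul_eq_zsmul]
  rfl

variable [CharZero O] {σ : O →+* O} {t : ℤ}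

theorem exists_apply_eq_three_mul (htO : ∀ x, ∃ t : ℤ, x + σ x = t)
    (hv : v * σ v = 1) (ht : v + σ v = t) (hdvd : (N : ℤ) ∣ t + 1)
    (hj : j ⟨F.val, Algebra.self_mem_adjoin_singleton _ _⟩ = Ideal.Quotient.mk _ v)
    (q : O ⧸ Ideal.span {(N : O)}) : ∃ y, j y = 3 * q := by
  obtain ⟨α, rfl⟩ := Ideal.Quotient.mk_surjective q
  obtain ⟨A, B, h⟩ := exists_three_mul_sub htO hv ht hdvd α
  refine ⟨A • 1 + B • ⟨F.val, Algebra.self_mem_adjoin_singleton _ _⟩, ?_⟩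
  rw [map_add, map_zsmul, map_zsmul, hj, map_one, eq_comm, ← sub_eq_zero]
  rw [Int.cast_natCast, ← Ideal.mem_span_singleton, ← Ideal.Quotient.eq_zero_iff_mem] at h
  simpa [zsmul_eq_mul, map_ofNat] using h

/-- The kernel of `j` is killed by `3`, whereas multiples of `3 k` are killed by `m`, which is prime
to `3`. -/
theorem zsmul_eq_zero_of_apply_eq_zero (hnO : ∀ x, ∃ n : ℤ, x * σ x = n)
    (hv : v * σ v = 1) (ht : v + σ v = t) (hdvd : (N : ℤ) ∣ t + 1)
    (htr : F.val.trace = -1) (hdet : F.val.det = 1)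
    (hj : j ⟨F.val, Algebra.self_mem_adjoin_singleton _ _⟩ = Ideal.Quotient.mk _ v)
    {m : ℕ} {k l : ℤ} (hN : N = 3 * m) (hkl : 3 * k + m * l = 1)
    {y : Algebra.adjoin (ZMod N) {F.val}} (hy : j ((3 * k : ℤ) • y) = 0) :
    (3 * k : ℤ) • y = 0 := by
  obtain ⟨a, b, rfl⟩ := exists_eq_zsmul htr hdet y
  rw [smul_add, smul_smul, smul_smul] at hy ⊢
  rw [map_add, map_zsmul, map_zsmul, hj, map_one] at hy
  have h : ((N : ℤ) : O) ∣ (3 * k * a : ℤ) + (3 * k * b : ℤ) * v := by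
    rw [Int.cast_natCast, ← Ideal.mem_span_singleton, ← Ideal.Quotient.eq_zero_iff_mem]
    simpa [zsmul_eq_mul, map_ofNat] using hy
  obtain ⟨h1, h2⟩ := dvd_three_mul_of_dvd hnO hv ht hdvd h
  have hN' : (N : ℤ) = 3 * m := by exact_mod_cast hN
  have key : ∀ c : ℤ, (N : ℤ) ∣ 3 * (3 * k * c) → ((3 * k * c : ℤ) : ZMod N) = 0 := by
    intro c hc
    rw [ZMod.intCast_zmod_eq_zero_iff_dvd]
    have : 3 * k * c = k * (3 * (3 * k * c)) + N * (k * c * l) := by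
      linear_combination (-3 * k * c) * hkl - k * c * l * hN'
    rw [this]
    exact dvd_add (hc.mul_left _) (dvd_mul_right _ _)
  rw [← Int.cast_smul_eq_zsmul (ZMod N), ← Int.cast_smul_eq_zsmul (ZMod N), key a h1, key b h2]
  simp

variable {M : Subgroup (GL (Fin 2) (ZMod N))} {jhat : M ≃* (O ⧸ Ideal.span {(N : O)})ˣ}

/-- The equality of kernels which identifies the reductions of `M` and of the unit group of
`O / N` modulo `3`. -/
theorem map_eq_one_iff_exists (htO : ∀ x, ∃ t : ℤ, x + σ x = t)
    (hnO : ∀ x, ∃ n : ℤ, x * σ x = n)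
    (hv : v * σ v = 1) (ht : v + σ v = t)
    (htr : F.val.trace = -1) (hdet : F.val.det = 1)
    (hMF : ∀ G ∈ M, G.val * F.val = F.val * G.val)
    (hMunit : ∀ G : GL (Fin 2) (ZMod N), G.val ∈ Algebra.adjoin (ZMod N) {F.val} → G ∈ M)
    (hj : j ⟨F.val, Algebra.self_mem_adjoin_singleton _ _⟩ = Ideal.Quotient.mk _ v)
    (hjhat : ∀ (G : M) (hG : G.val.val ∈ Algebra.adjoin (ZMod N) {F.val}),
      (jhat G : O ⧸ Ideal.span {(N : O)}) = j ⟨G.val.val, hG⟩)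
    {m : ℕ} {k l : ℤ} (hN : N = 3 * m) (hm : m ≠ 0) (hkl : 3 * k + m * l = 1) (h3 : 3 ∣ N)
    (G : M) :
    Matrix.GeneralLinearGroup.map (n := Fin 2) (ZMod.castHom h3 (ZMod 3)) G.val = 1 ↔
      ∃ q, (jhat G : O ⧸ Ideal.span {(N : O)}) = 1 + 3 * q := by
  have hdvd : (N : ℤ) ∣ t + 1 :=
    dvd_trace_add_one hnO hv ht (by simpa using dvd_sq_add_self_add_one htr hdet hj)
  have hN' : (N : ℤ) = 3 * m := by exact_mod_cast hN
  have hNQ : (3 : O ⧸ Ideal.span {(N : O)}) * m = 0 := by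
    have : ((N : ℕ) : O ⧸ Ideal.span {(N : O)}) = 0 := by
      rw [← map_natCast (Ideal.Quotient.mk _)]
      exact Ideal.Quotient.eq_zero_iff_mem.2 (Ideal.mem_span_singleton_self _)
    rw [← this]
    exact_mod_cast congrArg (Nat.cast (R := O ⧸ Ideal.span {(N : O)})) hN.symm
  have hklQ : (3 : O ⧸ Ideal.span {(N : O)}) * k + m * l = 1 := by
    exact_mod_cast congrArg (Int.cast (R := O ⧸ Ideal.span {(N : O)})) hkl
  rw [map_eq_one_iff hN hm hkl]
  constructor
  · intro hG
    -- In the kernel `G - 1 = 3 k (G - 1)`, and `3 (G - 1)` is in `(ℤ/N)[F]` because `G` commutes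
    -- with `F`. This brings `G` into the domain where `jhat` is known.
    have hsub : G.val.val = 1 + k • ((3 : ZMod N) • (G.val.val - 1)) := by
      have h1 : (3 : ZMod N) • (G.val.val - 1) = (3 : ℤ) • (G.val.val - 1) := by
        rw [← Int.cast_smul_eq_zsmul (ZMod N)]; norm_num
      rw [h1, smul_smul]
      have h2 : G.val.val - 1 = (3 * k + m * l) • (G.val.val - 1) := by rw [hkl, one_smul]
      rw [add_smul, hG, add_zero, mul_comm] at h2
      rw [← h2]; abel
    have hmem3 : (3 : ZMod N) • (G.val.val - 1) ∈ Algebra.adjoin (ZMod N) {F.val} := by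
      obtain ⟨x, y, hxy⟩ := exists_three_smul_eq htr hdet (hMF _ G.2)
      rw [smul_sub, hxy]
      exact sub_mem ((mem_adjoin_singleton_iff htr hdet).2 ⟨x, y, rfl⟩)
        (Subalgebra.smul_mem _ (one_mem _) _)
    have hmem : G.val.val - 1 ∈ Algebra.adjoin (ZMod N) {F.val} := by
      rw [sub_eq_iff_eq_add'.2 hsub]
      exact zsmul_mem hmem3 _
    have hmem' : G.val.val ∈ Algebra.adjoin (ZMod N) {F.val} := by
      simpa using add_mem hmem (one_mem _)
    refine ⟨k * j ⟨_, hmem⟩, ?_⟩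
    rw [hjhat G hmem']
    have : (⟨G.val.val, hmem'⟩ : Algebra.adjoin (ZMod N) {F.val}) =
        1 + (3 * k : ℤ) • ⟨_, hmem⟩ := by
      apply Subtype.ext
      change G.val.val = 1 + (3 * k : ℤ) • (G.val.val - 1)
      have h2 : G.val.val - 1 = (3 * k + m * l) • (G.val.val - 1) := by rw [hkl, one_smul]
      rw [add_smul, hG, add_zero] at h2
      rw [← h2]; abel
    rw [this, map_add, map_one, map_zsmul, zsmul_eq_mul]
    push_cast
    ring
  · rintro ⟨q, hq⟩
    obtain ⟨q', hq'⟩ : ∃ q', (((jhat G)⁻¹ : (O ⧸ Ideal.span {(N : O)})ˣ) :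
        O ⧸ Ideal.span {(N : O)}) = 1 + 3 * q' := by
      refine ⟨-q * ((jhat G)⁻¹ : (O ⧸ Ideal.span {(N : O)})ˣ), ?_⟩
      have := Units.mul_inv (jhat G)
      rw [hq] at this
      linear_combination this
    obtain ⟨y, hy⟩ := exists_apply_eq_three_mul htO hv ht hdvd hj q
    obtain ⟨y', hy'⟩ := exists_apply_eq_three_mul htO hv ht hdvd hj q'
    -- The factor `3 k = 1 - m l` acts trivially on `3 q`, since `3 m = 0` in `O/N`.
    have hjx : ∀ {q y}, j y = 3 * q → j (1 + (3 * k : ℤ) • y) = 1 + 3 * q := by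
      intro q y h
      rw [map_add, map_one, map_zsmul, h, zsmul_eq_mul]
      push_cast
      linear_combination 3 * q * hklQ - l * q * hNQ
    have hexp : (1 + (3 * k : ℤ) • y) * (1 + (3 * k : ℤ) • y') =
        1 + (3 * k : ℤ) • (y + y' + (3 * k : ℤ) • (y * y')) := by
      simp only [mul_add, add_mul, smul_mul_assoc, mul_smul_comm, one_mul, mul_one, smul_add]
      abel
    -- The product differs from `1` by a multiple of `3 k` that `j` kills.
    have hone : (1 + (3 * k : ℤ) • y) * (1 + (3 * k : ℤ) • y') = 1 := by
      rw [hexp, zsmul_eq_zero_of_apply_eq_zero hnO hv ht hdvd htr hdet hj hN hkl, add_zero]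
      have h1 := congrArg j hexp
      rw [map_mul, hjx hy, hjx hy', ← hq, ← hq', Units.mul_inv, map_add, map_one] at h1
      exact (left_eq_add.1 h1)
    have hone' : (1 + (3 * k : ℤ) • y).val * (1 + (3 * k : ℤ) • y').val = 1 :=
      congrArg Subtype.val hone
    let X : GL (Fin 2) (ZMod N) := ⟨_, _, hone', mul_eq_one_comm.1 hone'⟩
    have hX : X ∈ M := hMunit X (1 + (3 * k : ℤ) • y).2
    have hGX : G = ⟨X, hX⟩ := by
      apply jhat.injective
      apply Units.ext
      rw [hq, hjhat ⟨X, hX⟩ (1 + (3 * k : ℤ) • y).2]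
      exact (hjx hy).symm
    rw [hGX]
    change (m * l : ℤ) • ((1 + (3 * k : ℤ) • y.val) - 1) = 0
    rw [add_sub_cancel_left, smul_smul, ← Int.cast_smul_eq_zsmul (ZMod N)]
    have : ((m * l * (3 * k) : ℤ) : ZMod N) = 0 := by
      rw [ZMod.intCast_zmod_eq_zero_iff_dvd, hN']
      exact ⟨l * k, by ring⟩
    rw [this, zero_smul]

end KernelComparison

theorem nonempty_mulEquiv_of_ker_eq {G H K : Type*} [Group G] [Group H] [Group K] (f : G →* H)
    (g : G →* K) (hf : Function.Surjective f) (hg : Function.Surjective g)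
    (h : ∀ x, f x = 1 ↔ g x = 1) : Nonempty (H ≃* K) := by
  have hker : f.ker = g.ker := by
    ext x
    rw [MonoidHom.mem_ker, MonoidHom.mem_ker, h]
  exact ⟨(QuotientGroup.quotientKerEquivOfSurjective f hf).symm.trans
    ((QuotientGroup.quotientMulEquivOfEq hker).trans
      (QuotientGroup.quotientKerEquivOfSurjective g hg))⟩

/-- Units of `O / 3` lift to units of `O / N`. -/
theorem exists_unit_lift {O : Type*} [CommRing O] {N m : ℕ} {k l : ℤ} (hN : N = 3 * m)
    (hkl : 3 * k + m * l = 1) (h : Ideal.span {(N : O)} ≤ Ideal.span {(3 : O)}) :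
    Function.Surjective (Units.map (Ideal.Quotient.factor h).toMonoidHom) := by
  intro w
  obtain ⟨a, ha⟩ := Ideal.Quotient.mk_surjective (w : O ⧸ Ideal.span {(3 : O)})
  obtain ⟨b, hb⟩ := Ideal.Quotient.mk_surjective ((w⁻¹ : (O ⧸ Ideal.span {(3 : O)})ˣ) :
    O ⧸ Ideal.span {(3 : O)})
  have hab := w.mul_inv
  rw [← ha, ← hb, ← map_mul, ← map_one (Ideal.Quotient.mk _), Ideal.Quotient.eq,
    Ideal.mem_span_singleton] at hab
  obtain ⟨c, hc⟩ := hab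
  have hklO : (3 : O) * k + m * l = 1 := by exact_mod_cast congrArg (Int.cast (R := O)) hkl
  have hNO : (N : O) = 3 * m := by rw [hN]; push_cast; ring
  -- The lift is `a` modulo `3` and `1` modulo `m`.
  have hmul : Ideal.Quotient.mk (Ideal.span {(N : O)}) (m * l * a + 3 * k) *
      Ideal.Quotient.mk (Ideal.span {(N : O)}) (m * l * b + 3 * k) = 1 := by
    rw [← map_mul, ← map_one (Ideal.Quotient.mk _), Ideal.Quotient.eq, Ideal.mem_span_singleton,
      hNO]
    refine ⟨m * l ^ 2 * c + k * l * (a + b - 2), ?_⟩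
    linear_combination (3 * k + m * l + 1) * hklO + m ^ 2 * l ^ 2 * hc
  refine ⟨⟨_, _, hmul, (mul_comm _ _).trans hmul⟩, Units.ext ?_⟩
  change Ideal.Quotient.mk (Ideal.span {(3 : O)}) (m * l * a + 3 * k) = w
  rw [← ha, Ideal.Quotient.eq, Ideal.mem_span_singleton]
  exact ⟨k * (1 - a), by linear_combination a * hklO⟩

theorem nonempty_map_mulEquiv {N : ℕ} {O : Type*} [CommRing O] [CharZero O] {σ : O →+* O}
    {F : GL (Fin 2) (ZMod N)} {v : O} {t : ℤ}
    {j : Algebra.adjoin (ZMod N) {F.val} →+* O ⧸ Ideal.span {(N : O)}}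
    {M : Subgroup (GL (Fin 2) (ZMod N))} {jhat : M ≃* (O ⧸ Ideal.span {(N : O)})ˣ}
    (htO : ∀ x, ∃ t : ℤ, x + σ x = t)
    (hnO : ∀ x, ∃ n : ℤ, x * σ x = n)
    (hv : v * σ v = 1) (ht : v + σ v = t)
    (htr : F.val.trace = -1) (hdet : F.val.det = 1)
    (hMF : ∀ G ∈ M, G.val * F.val = F.val * G.val)
    (hMunit : ∀ G : GL (Fin 2) (ZMod N), G.val ∈ Algebra.adjoin (ZMod N) {F.val} → G ∈ M)
    (hj : j ⟨F.val, Algebra.self_mem_adjoin_singleton _ _⟩ = Ideal.Quotient.mk _ v)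
    (hjhat : ∀ (G : M) (hG : G.val.val ∈ Algebra.adjoin (ZMod N) {F.val}),
      (jhat G : O ⧸ Ideal.span {(N : O)}) = j ⟨G.val.val, hG⟩)
    {m : ℕ} {k l : ℤ} (hN : N = 3 * m) (hm : m ≠ 0) (hkl : 3 * k + m * l = 1) (h3 : 3 ∣ N) :
    Nonempty (M.map (Matrix.GeneralLinearGroup.map (n := Fin 2) (ZMod.castHom h3 (ZMod 3))) ≃*
      (O ⧸ Ideal.span {(3 : O)})ˣ) := by
  have hle : Ideal.span {(N : O)} ≤ Ideal.span {(3 : O)} := by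
    rw [Ideal.span_singleton_le_span_singleton, hN]
    exact ⟨m, by push_cast; ring⟩
  have h30 : (3 : O ⧸ Ideal.span {(3 : O)}) = 0 := by
    rw [← map_ofNat (Ideal.Quotient.mk _)]
    exact Ideal.Quotient.eq_zero_iff_mem.2 (Ideal.mem_span_singleton_self _)
  refine nonempty_mulEquiv_of_ker_eq
    ((Matrix.GeneralLinearGroup.map (n := Fin 2) (ZMod.castHom h3 (ZMod 3))).subgroupMap M)
    ((Units.map (Ideal.Quotient.factor hle).toMonoidHom).comp jhat.toMonoidHom)
    (MonoidHom.subgroupMap_surjective _ _)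
    ((exists_unit_lift hN hkl hle).comp jhat.surjective) fun G => ?_
  have h1 : (Matrix.GeneralLinearGroup.map (n := Fin 2)
      (ZMod.castHom h3 (ZMod 3))).subgroupMap M G = 1 ↔
      Matrix.GeneralLinearGroup.map (n := Fin 2) (ZMod.castHom h3 (ZMod 3)) G.val = 1 :=
    Subtype.ext_iff
  rw [h1, map_eq_one_iff_exists htO hnO hv ht htr hdet hMF hMunit hj hjhat hN hm hkl h3]
  change _ ↔ Units.map (Ideal.Quotient.factor hle).toMonoidHom (jhat G) = 1
  rw [Units.ext_iff]
  change _ ↔ Ideal.Quotient.factor hle (jhat G).val = 1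
  constructor
  · rintro ⟨q, hq⟩
    rw [hq, map_add, map_mul, map_one, map_ofNat, h30, zero_mul, add_zero]
  · intro h
    obtain ⟨α, hα⟩ := Ideal.Quotient.mk_surjective (jhat G).val
    rw [← hα, Ideal.Quotient.factor_mk, ← map_one (Ideal.Quotient.mk _), Ideal.Quotient.eq,
      Ideal.mem_span_singleton] at h
    obtain ⟨β, hβ⟩ := h
    refine ⟨Ideal.Quotient.mk _ β, ?_⟩
    rw [← hα, eq_add_of_sub_eq' hβ, map_add, map_mul, map_one, map_ofNat]

/-- The idempotent `e` splits `A`: the first factor is `f` on the `e`-part and `1` on the rest, and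
`f² = f⁻¹`. -/
theorem one_add_zsmul_mul_eq_one {A : Type*} [Ring A] {f : A} (hf : f ^ 3 = 1) {e : ℤ}
    (he : ∀ y : A, e • e • y = e • y) : (1 + e • (f - 1)) * (1 + e • (f ^ 2 - 1)) = 1 := by
  have h2 : (f - 1) * (f ^ 2 - 1) = 1 - f - f ^ 2 + 1 := by
    rw [sub_mul, mul_sub, one_mul, ← pow_succ', hf, mul_one]
    abel
  have h1 : (1 + e • (f - 1)) * (1 + e • (f ^ 2 - 1)) =
      1 + e • (f - 1) + (e • (f ^ 2 - 1) + e • e • ((f - 1) * (f ^ 2 - 1))) := by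
    rw [add_mul, one_mul, mul_add, mul_one, smul_mul_assoc, mul_smul_comm]
    abel
  have h3 : f - 1 + (f ^ 2 - 1 + (1 - f - f ^ 2 + 1)) = 0 := by abel
  rw [h1, he, h2, add_assoc, ← smul_add, ← smul_add, h3, smul_zero, add_zero]

/-- The matrix `X` that equals `F` modulo `3` and `1` modulo `m` lies in `M`, and `jhat` sends it to
`1` because `v ≡ 1` modulo `3`. Injectivity of `jhat` then gives `X = 1`. -/
theorem map_eq_one_of_three_dvd {N : ℕ} {O : Type*} [CommRing O]
    {F : GL (Fin 2) (ZMod N)} {v : O}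
    {j : Algebra.adjoin (ZMod N) {F.val} →+* O ⧸ Ideal.span {(N : O)}}
    {M : Subgroup (GL (Fin 2) (ZMod N))} {jhat : M ≃* (O ⧸ Ideal.span {(N : O)})ˣ}
    (hF : F ^ 3 = 1)
    (hMunit : ∀ G : GL (Fin 2) (ZMod N), G.val ∈ Algebra.adjoin (ZMod N) {F.val} → G ∈ M)
    (hj : j ⟨F.val, Algebra.self_mem_adjoin_singleton _ _⟩ = Ideal.Quotient.mk _ v)
    (hjhat : ∀ (G : M) (hG : G.val.val ∈ Algebra.adjoin (ZMod N) {F.val}),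
      (jhat G : O ⧸ Ideal.span {(N : O)}) = j ⟨G.val.val, hG⟩)
    {m : ℕ} {k l : ℤ} (hN : N = 3 * m) (hm : m ≠ 0) (hkl : 3 * k + m * l = 1) (h3 : 3 ∣ N)
    (hv : (3 : O) ∣ v - 1) :
    Matrix.GeneralLinearGroup.map (n := Fin 2) (ZMod.castHom h3 (ZMod 3)) F = 1 := by
  rw [map_eq_one_iff hN hm hkl]
  have hN' : (N : ℤ) = 3 * m := by exact_mod_cast hN
  have hF' : F.val ^ 3 = 1 := congrArg Units.val hF
  set f : Algebra.adjoin (ZMod N) {F.val} := ⟨F.val, Algebra.self_mem_adjoin_singleton _ _⟩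
  set e : ℤ := m * l with he
  have hf : f ^ 3 = 1 := Subtype.ext hF'
  have hee : ∀ y : Algebra.adjoin (ZMod N) {F.val}, e • e • y = e • y := by
    intro y
    have h1 : ((e * e - e : ℤ) : ZMod N) = 0 := by
      rw [ZMod.intCast_zmod_eq_zero_iff_dvd, hN']
      exact ⟨-(l * k), by rw [he]; linear_combination m * l * hkl⟩
    rw [smul_smul, ← sub_eq_zero, ← sub_smul, ← Int.cast_smul_eq_zsmul (ZMod N), h1, zero_smul]
  have hmul : (1 + e • (f - 1)) * (1 + e • (f ^ 2 - 1)) = 1 := one_add_zsmul_mul_eq_one hf hee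
  have hmul' : (1 + e • (f - 1)).val * (1 + e • (f ^ 2 - 1)).val = 1 := congrArg Subtype.val hmul
  let X : GL (Fin 2) (ZMod N) := ⟨_, _, hmul', mul_eq_one_comm.1 hmul'⟩
  have hX : X ∈ M := hMunit X (1 + e • (f - 1)).2
  have hX1 : (⟨X, hX⟩ : M) = 1 := by
    apply jhat.injective
    apply Units.ext
    rw [hjhat ⟨X, hX⟩ (1 + e • (f - 1)).2, map_one]
    change j (1 + e • (f - 1)) = 1
    obtain ⟨β, hβ⟩ := hv
    rw [map_add, map_zsmul, map_sub, map_one, hj, ← map_one (Ideal.Quotient.mk _), ← map_sub, hβ,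
      ← map_zsmul, ← map_add, Ideal.Quotient.eq, Ideal.mem_span_singleton]
    refine ⟨l * β, ?_⟩
    rw [zsmul_eq_mul, he, hN]
    push_cast
    ring
  have h1 : 1 + e • (F.val - 1) = 1 :=
    congrArg (fun G : M => G.val.val) hX1
  exact add_eq_left.1 h1

/-! ### The field `ℚ(√D)`, its conjugation and its integers. -/

section QuadraticField

variable {D : ℕ}

theorem rat_sq_ne (hsq : Squarefree D) (h1 : D ≠ 1) (r : ℚ) : r ^ 2 ≠ (D : ℚ) + 0 * r := by
  intro h
  rw [zero_mul, add_zero] at h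
  have hD : IsSquare ((D : ℕ) : ℚ) := ⟨r, by rw [← h, sq]⟩
  rw [Rat.isSquare_natCast_iff] at hD
  obtain ⟨n, hn⟩ := hD
  have := hsq n ⟨1, by rw [hn, mul_one]⟩
  rw [Nat.isUnit_iff] at this
  exact h1 (by rw [hn, this])

/-- `√D` as an element of `K`. -/
noncomputable def sqrtK (D : ℕ) : fieldK D :=
  ⟨((√(D : ℝ) : ℝ) : ℂ), IntermediateField.subset_adjoin ℚ _ rfl⟩

theorem sqrtK_sq : sqrtK D ^ 2 = D := by
  apply Subtype.ext
  change ((√(D : ℝ) : ℝ) : ℂ) ^ 2 = ((D : fieldK D) : ℂ)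
  rw [← Complex.ofReal_pow, Real.sq_sqrt (Nat.cast_nonneg D)]
  push_cast
  rfl

/-- The presentation of `K` by coordinates with respect to `1, √D`. -/
noncomputable def coordHom (D : ℕ) : QuadraticAlgebra ℚ (D : ℚ) 0 →ₐ[ℚ] fieldK D :=
  QuadraticAlgebra.lift ⟨sqrtK D, by
    rw [← sq, sqrtK_sq, zero_smul, add_zero, Algebra.smul_def, mul_one, map_natCast]⟩

theorem coordHom_apply (w : QuadraticAlgebra ℚ (D : ℚ) 0) :
    coordHom D w = (w.re : fieldK D) + w.im * sqrtK D := by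
  change w.re • (1 : fieldK D) + w.im • sqrtK D = _
  rw [Algebra.smul_def, Algebra.smul_def, mul_one]
  rfl

theorem coordHom_bijective (hsq : Squarefree D) (h1 : D ≠ 1) :
    Function.Bijective (coordHom D) := by
  have := Fact.mk (rat_sq_ne hsq h1)
  refine ⟨(coordHom D).toRingHom.injective, ?_⟩
  rintro ⟨x, hx⟩
  have hle : fieldK D ≤ ((fieldK D).val.comp (coordHom D)).fieldRange := by
    refine IntermediateField.adjoin_le_iff.2 ?_
    rintro _ rfl
    refine ⟨⟨0, 1⟩, ?_⟩
    change ((coordHom D ⟨0, 1⟩ : fieldK D) : ℂ) = _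
    rw [coordHom_apply]
    simp [sqrtK]
  obtain ⟨w, hw⟩ := hle hx
  exact ⟨w, Subtype.ext hw⟩

noncomputable def coordEquiv (hsq : Squarefree D) (h1 : D ≠ 1) :
    QuadraticAlgebra ℚ (D : ℚ) 0 ≃ₐ[ℚ] fieldK D :=
  AlgEquiv.ofBijective (coordHom D) (coordHom_bijective hsq h1)

/-- The nontrivial automorphism of `K`. -/
noncomputable def conjK (hsq : Squarefree D) (h1 : D ≠ 1) : fieldK D →+* fieldK D :=
  ((coordEquiv hsq h1).toAlgHom.toRingHom.comp
    (starRingEnd (QuadraticAlgebra ℚ (D : ℚ) 0))).comp (coordEquiv hsq h1).symm.toAlgHom.toRingHom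

theorem conjK_apply (hsq : Squarefree D) (h1 : D ≠ 1) (a b : ℚ) :
    conjK hsq h1 (a + b * sqrtK D) = a - b * sqrtK D := by
  have h : (coordEquiv hsq h1) ⟨a, b⟩ = (a : fieldK D) + b * sqrtK D := coordHom_apply _
  change (coordEquiv hsq h1) (star ((coordEquiv hsq h1).symm _)) = _
  rw [← h, AlgEquiv.symm_apply_apply]
  refine (coordHom_apply _).trans ?_
  simp
  ring

theorem exists_coord (hsq : Squarefree D) (h1 : D ≠ 1) (x : fieldK D) :
    ∃ a b : ℚ, x = a + b * sqrtK D := by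
  obtain ⟨w, rfl⟩ := (coordHom_bijective hsq h1).2 x
  exact ⟨w.re, w.im, coordHom_apply w⟩

theorem coord_unique (hsq : Squarefree D) (h1 : D ≠ 1) {a b a' b' : ℚ}
    (h : (a : fieldK D) + b * sqrtK D = a' + b' * sqrtK D) : a = a' ∧ b = b' := by
  have := (coordHom_bijective hsq h1).1 (a₁ := ⟨a, b⟩) (a₂ := ⟨a', b'⟩)
    (by rw [coordHom_apply, coordHom_apply]; exact h)
  exact ⟨congrArg QuadraticAlgebra.re this, congrArg QuadraticAlgebra.im this⟩

theorem norm_coord (hsq : Squarefree D) (h1 : D ≠ 1) (a b : ℚ) :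
    Algebra.norm ℚ ((a : fieldK D) + b * sqrtK D) = a ^ 2 - D * b ^ 2 := by
  have h : (coordEquiv hsq h1) ⟨a, b⟩ = (a : fieldK D) + b * sqrtK D := coordHom_apply _
  rw [← h, Algebra.norm_eq_of_algEquiv, Algebra.norm_apply]
  refine (QuadraticAlgebra.det_toLinearMap_eq_norm _).trans ?_
  rw [QuadraticAlgebra.norm_def]
  simp
  ring

theorem exists_int_of_isIntegral {q : ℚ} (h : IsIntegral ℤ (q : fieldK D)) : ∃ n : ℤ, q = n := by
  have h2 : IsIntegral ℤ (algebraMap ℚ (fieldK D) q) := h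
  rw [isIntegral_algebraMap_iff (algebraMap ℚ (fieldK D)).injective] at h2
  obtain ⟨n, hn⟩ := IsIntegrallyClosed.isIntegral_iff.1 h2
  exact ⟨n, hn.symm⟩

theorem algebraMap_O_injective (D : ℕ) :
    Function.Injective (algebraMap (𝓞 (fieldK D)) (fieldK D)) :=
  NumberField.RingOfIntegers.coe_injective

instance charZero_O (D : ℕ) : CharZero (𝓞 (fieldK D)) :=
  ⟨fun m n h => Nat.cast_injective (R := fieldK D) (by
    simpa only [map_natCast] using congrArg (algebraMap (𝓞 (fieldK D)) (fieldK D)) h)⟩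

/-- Conjugation on the ring of integers of `K`. -/
noncomputable def conjO (hsq : Squarefree D) (h1 : D ≠ 1) : 𝓞 (fieldK D) →+* 𝓞 (fieldK D) :=
  NumberField.RingOfIntegers.mapRingHom (conjK hsq h1)

theorem exists_eq_intCast_of_coe_eq {x : 𝓞 (fieldK D)} {q : ℚ}
    (h : algebraMap (𝓞 (fieldK D)) (fieldK D) x = q) :
    ∃ n : ℤ, x = n ∧ q = n := by
  obtain ⟨n, hn⟩ := exists_int_of_isIntegral (D := D) (q := q) (h ▸ x.isIntegral_coe)
  refine ⟨n, algebraMap_O_injective D ?_, hn⟩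
  rw [h, hn]
  simp

theorem coe_conjO (hsq : Squarefree D) (h1 : D ≠ 1) {x : 𝓞 (fieldK D)} {a b : ℚ}
    (h : (algebraMap (𝓞 (fieldK D)) (fieldK D) x) = a + b * sqrtK D) :
    algebraMap (𝓞 (fieldK D)) (fieldK D) (conjO hsq h1 x) = a - b * sqrtK D := by
  rw [← conjK_apply hsq h1, ← h]
  rfl

theorem exists_add_conjO (hsq : Squarefree D) (h1 : D ≠ 1) (x : 𝓞 (fieldK D)) :
    ∃ t : ℤ, x + conjO hsq h1 x = t := by
  obtain ⟨a, b, h⟩ := exists_coord hsq h1 (algebraMap (𝓞 (fieldK D)) (fieldK D) x)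
  have h2 : algebraMap (𝓞 (fieldK D)) (fieldK D) (x + conjO hsq h1 x) =
      ((2 * a : ℚ) : fieldK D) := by
    rw [map_add, coe_conjO hsq h1 h, h]
    push_cast
    ring
  exact (exists_eq_intCast_of_coe_eq h2).imp fun _ h => h.1

theorem coe_mul_conjO (hsq : Squarefree D) (h1 : D ≠ 1) {x : 𝓞 (fieldK D)} {a b : ℚ}
    (h : (algebraMap (𝓞 (fieldK D)) (fieldK D) x) = a + b * sqrtK D) :
    algebraMap (𝓞 (fieldK D)) (fieldK D) (x * conjO hsq h1 x) =
      ((a ^ 2 - D * b ^ 2 : ℚ) : fieldK D) := by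
  rw [map_mul, coe_conjO hsq h1 h, h]
  push_cast
  linear_combination (-(b : fieldK D) ^ 2) * sqrtK_sq (D := D)

theorem exists_mul_conjO (hsq : Squarefree D) (h1 : D ≠ 1) (x : 𝓞 (fieldK D)) :
    ∃ n : ℤ, x * conjO hsq h1 x = n := by
  obtain ⟨a, b, h⟩ := exists_coord hsq h1 (algebraMap (𝓞 (fieldK D)) (fieldK D) x)
  exact (exists_eq_intCast_of_coe_eq (coe_mul_conjO hsq h1 h)).imp fun _ h => h.1

theorem mul_conjO_eq_one (hsq : Squarefree D) (h1 : D ≠ 1) {x : 𝓞 (fieldK D)}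
    (h : Algebra.norm ℚ (algebraMap (𝓞 (fieldK D)) (fieldK D) x) = 1) : x * conjO hsq h1 x = 1 := by
  obtain ⟨a, b, hx⟩ := exists_coord hsq h1 (algebraMap (𝓞 (fieldK D)) (fieldK D) x)
  apply algebraMap_O_injective D
  rw [hx, norm_coord hsq h1] at h
  rw [coe_mul_conjO hsq h1 hx, h]
  simp

/-- `√D` as an algebraic integer. -/
noncomputable def sqrtO (D : ℕ) : 𝓞 (fieldK D) :=
  ⟨sqrtK D, by
    refine IsIntegral.of_pow two_pos ?_
    rw [sqrtK_sq]
    exact isIntegral_natCast _⟩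

theorem coe_sqrtO : algebraMap (𝓞 (fieldK D)) (fieldK D) (sqrtO D) = sqrtK D := rfl

theorem sqrtO_sq : sqrtO D ^ 2 = D := by
  apply algebraMap_O_injective D
  rw [map_pow, coe_sqrtO, sqrtK_sq, map_natCast]

/-- The square of the denominator of `q` divides `D`. -/
theorem exists_eq_intCast_of_sq_mul (hsq : Squarefree D) {q : ℚ} {n : ℤ}
    (h : q ^ 2 * D = n) : ∃ l : ℤ, q = l := by
  have h2 : (q.num : ℚ) ^ 2 * D = n * (q.den : ℚ) ^ 2 := by
    have hq := Rat.mul_den_eq_num q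
    rw [← hq, ← h]
    ring
  have h3 : q.num ^ 2 * D = n * (q.den : ℤ) ^ 2 := by exact_mod_cast h2
  have h4 : (q.den : ℤ) ^ 2 ∣ q.num ^ 2 * D := ⟨n, by rw [h3, mul_comm]⟩
  have hc : IsCoprime ((q.den : ℤ) ^ 2) (q.num ^ 2) :=
    (Rat.isCoprime_num_den q).symm.pow
  have h5 : q.den * q.den ∣ D := by
    have := hc.dvd_of_dvd_mul_left h4
    rw [← sq]
    exact_mod_cast this
  have h6 : q.den = 1 := Nat.isUnit_iff.1 (hsq _ h5)
  exact ⟨q.num, ((Rat.den_eq_one_iff q).1 h6).symm⟩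

/-- For `x = a + b √D` with rational `a`, `b`, the trace shows that `2 a` is an integer, and the
square of `x` minus its conjugate shows that `(2 b)² D` is one. The factor `2` is harmless modulo
`3`. -/
theorem exists_two_mul_eq (hsq : Squarefree D) (h1 : D ≠ 1) (x : 𝓞 (fieldK D)) :
    ∃ a b : ℤ, 2 * x = a + b * sqrtO D := by
  obtain ⟨a, b, h⟩ := exists_coord hsq h1 (algebraMap (𝓞 (fieldK D)) (fieldK D) x)
  have h2 : algebraMap (𝓞 (fieldK D)) (fieldK D) (x + conjO hsq h1 x) =
      ((2 * a : ℚ) : fieldK D) := by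
    rw [map_add, coe_conjO hsq h1 h, h]
    push_cast
    ring
  have h3 : algebraMap (𝓞 (fieldK D)) (fieldK D) ((x - conjO hsq h1 x) ^ 2) =
      (((2 * b) ^ 2 * D : ℚ) : fieldK D) := by
    rw [map_pow, map_sub, coe_conjO hsq h1 h, h]
    push_cast
    linear_combination 4 * (b : fieldK D) ^ 2 * sqrtK_sq (D := D)
  obtain ⟨m, -, hm⟩ := exists_eq_intCast_of_coe_eq h2
  obtain ⟨n, -, hn⟩ := exists_eq_intCast_of_coe_eq h3
  obtain ⟨l, hl⟩ : ∃ l : ℤ, 2 * b = l :=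
    exists_eq_intCast_of_sq_mul hsq hn
  refine ⟨m, l, algebraMap_O_injective D ?_⟩
  rw [map_mul, map_add, map_mul, coe_sqrtO, h, map_intCast, map_intCast, map_ofNat]
  have hm' : ((2 * a : ℚ) : fieldK D) = m := by rw [hm]; simp
  have hl' : ((2 * b : ℚ) : fieldK D) = l := by rw [hl]; simp
  rw [← hm', ← hl']
  push_cast
  ring

theorem three_dvd_of_dvd (hsq : Squarefree D) (h1 : D ≠ 1) {a b : ℤ}
    (h : (3 : 𝓞 (fieldK D)) ∣ a + b * sqrtO D) : 3 ∣ a ∧ 3 ∣ b := by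
  obtain ⟨x, hx⟩ := h
  obtain ⟨a', b', h2⟩ := exists_two_mul_eq hsq h1 x
  have h3 : ((2 * a : ℤ) : 𝓞 (fieldK D)) + ((2 * b : ℤ) : 𝓞 (fieldK D)) * sqrtO D =
      ((3 * a' : ℤ) : 𝓞 (fieldK D)) + ((3 * b' : ℤ) : 𝓞 (fieldK D)) * sqrtO D := by
    push_cast
    linear_combination 2 * hx + 3 * h2
  have h4 := congrArg (algebraMap (𝓞 (fieldK D)) (fieldK D)) h3
  rw [map_add, map_add, map_mul, map_mul, coe_sqrtO, map_intCast, map_intCast, map_intCast,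
    map_intCast] at h4
  obtain ⟨h5, h6⟩ := coord_unique hsq h1 (a := ((2 * a : ℤ) : ℚ)) (b := ((2 * b : ℤ) : ℚ))
    (a' := ((3 * a' : ℤ) : ℚ)) (b' := ((3 * b' : ℤ) : ℚ)) (by simpa using h4)
  have h5 : 2 * a = 3 * a' := by exact_mod_cast h5
  have h6 : 2 * b = 3 * b' := by exact_mod_cast h6
  omega

end QuadraticField

/-! ### The unit group of `𝓞_K / 3`. -/

section UnitsModThree

instance fintypeQuadraticAlgebra (a : ZMod 3) : Fintype (QuadraticAlgebra (ZMod 3) a 0) :=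
  Fintype.ofEquiv _ (QuadraticAlgebra.equivProd a 0).symm

set_option maxRecDepth 4000 in
theorem nonempty_units_mulEquiv_split :
    Nonempty ((QuadraticAlgebra (ZMod 3) 1 0)ˣ ≃* Multiplicative (ZMod 2 × ZMod 2)) := by
  have hcard : Fintype.card (QuadraticAlgebra (ZMod 3) 1 0)ˣ = 4 := by decide
  have hsq : ∀ x : (QuadraticAlgebra (ZMod 3) 1 0)ˣ, x ^ 2 = 1 := by decide
  have : Nontrivial (QuadraticAlgebra (ZMod 3) 1 0)ˣ :=
    Fintype.one_lt_card_iff_nontrivial.1 (by rw [hcard]; norm_num)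
  have : IsKleinFour (QuadraticAlgebra (ZMod 3) 1 0)ˣ :=
    ⟨by rw [Nat.card_eq_fintype_card, hcard],
      (Nat.dvd_prime Nat.prime_two).1 (Monoid.exponent_dvd_of_forall_pow_eq_one hsq)
        |>.resolve_left fun h => not_subsingleton _ (Monoid.exp_eq_one_iff.1 h)⟩
  exact IsKleinFour.nonempty_mulEquiv

/-- The exponents are bounded so that `decide` can check the hypothesis on `g`. -/
theorem nonempty_mulEquiv_zmod {G : Type} [Group G] {n : ℕ} (hn : Nat.card G = n)
    {g : G} (hg : ∀ x : G, ∃ i : Fin n, g ^ (i : ℕ) = x) :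
    Nonempty (G ≃* Multiplicative (ZMod n)) := by
  have : IsCyclic G := ⟨g, fun x => by
    obtain ⟨i, hi⟩ := hg x
    exact ⟨((i : ℕ) : ℤ), (zpow_natCast g i).trans hi⟩⟩
  exact ⟨mulEquivOfCyclicCardEq (by rw [hn]; exact (Nat.card_zmod n).symm)⟩

set_option maxRecDepth 4000 in
theorem nonempty_units_mulEquiv_inert :
    Nonempty ((QuadraticAlgebra (ZMod 3) 2 0)ˣ ≃* Multiplicative (ZMod 8)) := by
  have h : Fintype.card (QuadraticAlgebra (ZMod 3) 2 0)ˣ = 8 := by decide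
  have hg : ∀ x : (QuadraticAlgebra (ZMod 3) 2 0)ˣ, ∃ i : Fin 8,
      (⟨⟨1, 1⟩, ⟨2, 1⟩, by decide, by decide⟩ :
        (QuadraticAlgebra (ZMod 3) 2 0)ˣ) ^ (i : ℕ) = x := by
    decide
  exact nonempty_mulEquiv_zmod (by rw [Nat.card_eq_fintype_card, h]) hg

set_option maxRecDepth 4000 in
theorem nonempty_units_mulEquiv_ramified :
    Nonempty ((QuadraticAlgebra (ZMod 3) 0 0)ˣ ≃* Multiplicative (ZMod 6)) := by
  have h : Fintype.card (QuadraticAlgebra (ZMod 3) 0 0)ˣ = 6 := by decide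
  -- With `ε² = 0`, the generator is the product of `-1`, of order `2`, and `1 + ε`, of order `3`.
  have hg : ∀ x : (QuadraticAlgebra (ZMod 3) 0 0)ˣ, ∃ i : Fin 6,
      (⟨⟨2, 2⟩, ⟨2, 1⟩, by decide, by decide⟩ :
        (QuadraticAlgebra (ZMod 3) 0 0)ˣ) ^ (i : ℕ) = x := by
    decide
  exact nonempty_mulEquiv_zmod (by rw [Nat.card_eq_fintype_card, h]) hg

theorem nonempty_quotient_three_ringEquiv {D : ℕ} (hsq : Squarefree D) (h1 : D ≠ 1) :
    Nonempty (QuadraticAlgebra (ZMod 3) (D : ZMod 3) 0 ≃+*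
      𝓞 (fieldK D) ⧸ Ideal.span {(3 : 𝓞 (fieldK D))}) := by
  have h30 : ((3 : ℕ) : 𝓞 (fieldK D) ⧸ Ideal.span {(3 : 𝓞 (fieldK D))}) = 0 := by
    rw [← map_natCast (Ideal.Quotient.mk _)]
    exact Ideal.Quotient.eq_zero_iff_mem.2 (Ideal.mem_span_singleton_self _)
  have : Nontrivial (𝓞 (fieldK D) ⧸ Ideal.span {(3 : 𝓞 (fieldK D))}) := by
    refine Ideal.Quotient.nontrivial_iff.2 fun h => ?_
    rw [Ideal.eq_top_iff_one, Ideal.mem_span_singleton] at h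
    have := (three_dvd_of_dvd hsq h1 (a := 1) (b := 0) (by simpa using h)).1
    omega
  have := (CharP.charP_iff_prime_eq_zero Nat.prime_three).2 h30
  let _ := ZMod.algebra (𝓞 (fieldK D) ⧸ Ideal.span {(3 : 𝓞 (fieldK D))}) 3
  let s : 𝓞 (fieldK D) ⧸ Ideal.span {(3 : 𝓞 (fieldK D))} := Ideal.Quotient.mk _ (sqrtO D)
  have hs : s * s = (D : ZMod 3) • 1 + (0 : ZMod 3) • s := by
    rw [zero_smul, add_zero, Algebra.smul_def, mul_one, map_natCast, ← sq, ← map_pow, sqrtO_sq,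
      map_natCast]
  have happ : ∀ a b : ℤ, QuadraticAlgebra.lift ⟨s, hs⟩ ⟨(a : ZMod 3), (b : ZMod 3)⟩ =
      Ideal.Quotient.mk _ (a + b * sqrtO D) := by
    intro a b
    change (a : ZMod 3) • 1 + (b : ZMod 3) • s = _
    rw [Algebra.smul_def, Algebra.smul_def, mul_one, map_intCast, map_intCast, map_add, map_mul,
      map_intCast, map_intCast]
  refine ⟨RingEquiv.ofBijective (QuadraticAlgebra.lift ⟨s, hs⟩).toRingHom
    ⟨(injective_iff_map_eq_zero _).2 ?_, ?_⟩⟩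
  · rintro ⟨a, b⟩ h
    obtain ⟨a, rfl⟩ := ZMod.intCast_surjective a
    obtain ⟨b, rfl⟩ := ZMod.intCast_surjective b
    have h2 := (happ a b).symm.trans h
    rw [Ideal.Quotient.eq_zero_iff_mem, Ideal.mem_span_singleton] at h2
    obtain ⟨ha, hb⟩ := three_dvd_of_dvd hsq h1 h2
    rw [(ZMod.intCast_zmod_eq_zero_iff_dvd a 3).2 (by exact_mod_cast ha),
      (ZMod.intCast_zmod_eq_zero_iff_dvd b 3).2 (by exact_mod_cast hb)]
    rfl
  · intro q
    obtain ⟨x, rfl⟩ := Ideal.Quotient.mk_surjective q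
    obtain ⟨a, b, h⟩ := exists_two_mul_eq hsq h1 x
    -- The signs appear because `2 = -1` modulo `3`.
    refine ⟨⟨((-a : ℤ) : ZMod 3), ((-b : ℤ) : ZMod 3)⟩, (happ _ _).trans ?_⟩
    rw [Ideal.Quotient.eq, Ideal.mem_span_singleton]
    refine ⟨-x, ?_⟩
    push_cast
    linear_combination h

end UnitsModThree

/-! ### The unit of norm one and trace `d - 1`. -/

section NormOneUnit

variable {D : ℕ}

/-- An element of norm one and rational part `(d - 1) / 2`. -/
theorem add_conjO_of_hasRationalPart (hsq : Squarefree D) (h1 : D ≠ 1) {d : ℕ}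
    {u : (𝓞 (fieldK D))ˣ} (h : HasRationalPart d D u) :
    (u : 𝓞 (fieldK D)) + conjO hsq h1 u = ((d - 1 : ℤ) : 𝓞 (fieldK D)) := by
  obtain ⟨b, hb⟩ := h
  have hu : algebraMap (𝓞 (fieldK D)) (fieldK D) u =
      (((d - 1) / 2 : ℚ) : fieldK D) + b * sqrtK D := by
    apply Subtype.ext
    refine hb.trans ?_
    change _ = (((((d - 1) / 2 : ℚ) : fieldK D)) : ℂ) + ((b : fieldK D) : ℂ) * (sqrtK D : ℂ)
    push_cast
    rfl
  apply algebraMap_O_injective D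
  rw [map_add, coe_conjO hsq h1 hu, hu, map_intCast]
  push_cast
  ring

/-- If `(d - 3) (d + 1) = f² D` with `3` dividing `d - 3` and `f`, then a unit of norm one and
rational part `(d - 1) / 2` is trivial modulo `3`. -/
theorem three_dvd_sub_one (hsq : Squarefree D) (h1 : D ≠ 1) {d : ℕ} {u : 𝓞 (fieldK D)}
    (hu : u * conjO hsq h1 u = 1) (ht : u + conjO hsq h1 u = ((d - 1 : ℤ) : 𝓞 (fieldK D)))
    {f : ℤ} (hf : ((d : ℤ) - 3) * ((d : ℤ) + 1) = f ^ 2 * D) (hf3 : 3 ∣ f) (hd3 : 3 ∣ d) :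
    (3 : 𝓞 (fieldK D)) ∣ u - 1 := by
  have hfO : ((d : 𝓞 (fieldK D)) - 3) * (d + 1) = f ^ 2 * D := by
    exact_mod_cast congrArg (Int.cast (R := 𝓞 (fieldK D))) hf
  push_cast at ht
  -- Writing `u'` for the conjugate, `(u - u')² = (d - 1)² - 4 = (d - 3) (d + 1) = f² D`.
  have hprod : (u - conjO hsq h1 u - f * sqrtO D) * (u - conjO hsq h1 u + f * sqrtO D) = 0 := by
    linear_combination (u + conjO hsq h1 u + d - 1) * ht - 4 * hu + hfO - f ^ 2 * sqrtO_sq (D := D)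
  obtain ⟨g, rfl⟩ := hf3
  obtain ⟨e, rfl⟩ := hd3
  have key : ∃ w, u - conjO hsq h1 u = 3 * w := by
    rcases mul_eq_zero.1 hprod with h | h
    · exact ⟨g * sqrtO D, by push_cast at h; linear_combination h⟩
    · exact ⟨-(g * sqrtO D), by push_cast at h; linear_combination h⟩
  obtain ⟨w, hw⟩ := key
  -- From `2 (u - 1) = (d - 3) + (u - u')` and `2 = 3 - 1`.
  refine ⟨u - e - w, ?_⟩
  push_cast at ht
  linear_combination -ht - hw

end NormOneUnit

theorem one_lt_dbar {d : ℕ} (hd : 4 ≤ d) : 1 < dbar d := by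
  unfold dbar
  split_ifs <;> omega

theorem isTypeZ_iff {d : ℕ} {F : GLd d} : IsTypeZ d F ↔
    ∃ P : GLd d, F.val * P.val = P.val * !![0, -1; 1, -1] := by
  rw [IsTypeZ, isConj_comm, isConj_iff]
  refine exists_congr fun P => ?_
  rw [mul_inv_eq_iff_eq_mul, eq_comm, Units.ext_iff]
  rfl

/-! ### The determinant of a canonical symmetry. -/

section Determinant

theorem pow_mul_pow_of_mul_eq_smul {A : Type*} [Ring A] [Algebra ℂ A] {h w : A} {c : ℂ}
    (hw : h * w = c • (w * h)) (a b : ℕ) : h ^ b * w ^ a = c ^ (a * b) • (w ^ a * h ^ b) := by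
  have h1 : ∀ a : ℕ, h * w ^ a = c ^ a • (w ^ a * h) := by
    intro a
    induction a with
    | zero => simp
    | succ a ih =>
      rw [pow_succ, ← mul_assoc, ih, smul_mul_assoc, mul_assoc, hw, mul_smul_comm, smul_smul,
        ← pow_succ, mul_assoc]
  induction b with
  | zero => simp
  | succ b ih =>
    rw [pow_succ', mul_assoc, ih, mul_smul_comm, ← mul_assoc, h1, smul_mul_assoc, smul_smul,
      mul_assoc, ← pow_succ', ← pow_add, Nat.mul_succ]

variable {d : ℕ} [NeZero d]

theorem omega_isPrimitiveRoot : IsPrimitiveRoot (omega d) d :=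
  Complex.isPrimitiveRoot_exp d (NeZero.ne d)

theorem omega_pow_eq_iff {m n : ℕ} : omega d ^ m = omega d ^ n ↔ m ≡ n [MOD d] := by
  have h := omega_isPrimitiveRoot (d := d)
  rw [(h.isOfFinOrder (NeZero.ne d)).pow_eq_pow_iff_modEq, ← h.eq_orderOf]

theorem clock_mul_shift : clock d * shift d = omega d • (shift d * clock d) := by
  ext i j
  rw [clock, Matrix.diagonal_mul, Matrix.smul_apply, Matrix.mul_diagonal, shift, Matrix.of_apply]
  split_ifs with h
  · rw [mul_one, one_mul, h, smul_eq_mul, ← pow_succ']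
    rw [omega_pow_eq_iff, ← ZMod.natCast_eq_natCast_iff]
    simp
  · simp

theorem disp_mul_disp (p q : Fin 2 → ZMod (dbar d)) :
    omega d ^ ((p 0).val * (q 1).val) • (disp d p * disp d q) =
      omega d ^ ((q 0).val * (p 1).val) • (disp d q * disp d p) := by
  have key : ∀ p q : Fin 2 → ZMod (dbar d), disp d p * disp d q =
      (omega d ^ ((q 0).val * (p 1).val) *
        (tau d ^ ((p 0).val * (p 1).val) * tau d ^ ((q 0).val * (q 1).val))) •
        (shift d ^ ((p 0).val + (q 0).val) * clock d ^ ((p 1).val + (q 1).val)) := by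
    intro p q
    rw [disp, disp, smul_mul_smul_comm, mul_assoc (shift d ^ _), ← mul_assoc (clock d ^ _),
      pow_mul_pow_of_mul_eq_smul (clock_mul_shift (d := d)), smul_mul_assoc, mul_smul_comm,
      smul_smul, mul_assoc (shift d ^ (q 0).val), ← mul_assoc (shift d ^ _) (shift d ^ _),
      ← pow_add (shift d), ← pow_add (clock d)]
    congr 1
    ring
  rw [key, key, smul_smul, smul_smul, add_comm (q 0).val, add_comm (q 1).val]
  congr 1
  ring

theorem disp_e0 (hd : 4 ≤ d) : disp d ![1, 0] = shift d := by
  have := Fact.mk (one_lt_dbar hd)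
  simp [disp, ZMod.val_one]

theorem disp_e1 (hd : 4 ≤ d) : disp d ![0, 1] = clock d := by
  have := Fact.mk (one_lt_dbar hd)
  simp [disp, ZMod.val_one]

/-- Conjugation by `U` preserves `h w = ω w h`, while the images of `w` and `h` commute up to `ω ^
det F`. Since `ω` has order `d`, this sees `det F` modulo `d` only, not modulo `d̄`. -/
theorem Implements.modEq (hd : 4 ≤ d) {U : Matrix (ZMod d) (ZMod d) ℂ} {F : GLd d}
    (h : Implements d U F) :
    (F.val 0 1).val * (F.val 1 0).val + 1 ≡ (F.val 0 0).val * (F.val 1 1).val [MOD d] := by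
  obtain ⟨hU, hUF⟩ := h
  have hUU : star U * U = 1 := Matrix.UnitaryGroup.star_mul_self ⟨U, hU⟩
  have h0 := hUF ![1, 0]
  have h1 := hUF ![0, 1]
  rw [disp_e0 hd] at h0
  rw [disp_e1 hd] at h1
  have hmul : ∀ X Y, U * X * star U * (U * Y * star U) = U * (X * Y) * star U := by
    intro X Y
    rw [← mul_assoc, ← mul_assoc, mul_assoc (U * X), hUU, mul_one, mul_assoc U X Y]
  have hcomm := disp_mul_disp (F.val *ᵥ ![0, 1]) (F.val *ᵥ ![1, 0])
  rw [← h0, ← h1, hmul, hmul, clock_mul_shift, mul_smul_comm, smul_mul_assoc, smul_smul,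
    ← pow_succ] at hcomm
  have hne : U * (shift d * clock d) * star U ≠ 0 := by
    intro hz
    have h2 : star U * (U * (shift d * clock d) * star U) * U = shift d * clock d := by
      rw [← mul_assoc, ← mul_assoc, hUU, one_mul, mul_assoc, hUU, mul_one]
    rw [hz, mul_zero, zero_mul] at h2
    have h3 := congrFun (congrFun h2 (0 + 1)) 0
    rw [clock, Matrix.mul_diagonal, shift, Matrix.of_apply, if_pos rfl] at h3
    simp at h3
  have hpow := smul_left_injective ℂ hne hcomm
  have := omega_pow_eq_iff.1 hpow
  simpa [Matrix.mulVec, dotProduct, Fin.sum_univ_two] using this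

theorem trace_pow_three {R : Type*} [CommRing R] (F : Matrix (Fin 2) (Fin 2) R) :
    (F ^ 3).trace = F.trace ^ 3 - 3 * F.trace * F.det := by
  simp only [pow_succ, pow_zero, one_mul, Matrix.trace_fin_two, Matrix.det_fin_two,
    Matrix.mul_apply, Fin.sum_univ_two]
  ring

/-- The trace of `F³ = 1` gives `3 (det F - 1) = 0` modulo `d̄`. For even `d` this supplies the
factor `2` missing from the congruence modulo `d`. -/
theorem IsCanonicalSymmetry.det_eq_one (hd : 4 ≤ d) {z : ZMod d → ℂ} {F : GLd d}
    (hF : IsCanonicalSymmetry d z F) : F.val.det = 1 := by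
  have : NeZero (dbar d) := ⟨by have := one_lt_dbar hd; omega⟩
  obtain ⟨U, hU⟩ := hF.implemented
  have hmod := (Nat.modEq_iff_dvd.1 (hU.modEq hd))
  have h3 : F ^ 3 = 1 := hF.order ▸ pow_orderOf_eq_one F
  have h3' : F.val ^ 3 = 1 := congrArg Units.val h3
  have htr := trace_pow_three F.val
  rw [h3', hF.trace, Matrix.trace_one] at htr
  obtain ⟨n, hn⟩ : ∃ n : ℤ, n = (F.val 0 0).val * (F.val 1 1).val -
    ((F.val 0 1).val * (F.val 1 0).val : ℤ) := ⟨_, rfl⟩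
  have hdet : F.val.det = (n : ZMod (dbar d)) := by
    rw [hn, Matrix.det_fin_two]
    push_cast
    simp only [ZMod.natCast_zmod_val]
  rw [hdet] at htr ⊢
  have h4 : ((3 * (n - 1) : ℤ) : ZMod (dbar d)) = 0 := by
    simp only [Fintype.card_fin] at htr
    push_cast at htr ⊢
    linear_combination -htr
  rw [ZMod.intCast_zmod_eq_zero_iff_dvd] at h4
  rw [← sub_eq_zero, ← Int.cast_one, ← Int.cast_sub, ZMod.intCast_zmod_eq_zero_iff_dvd]
  have h5 : (d : ℤ) ∣ n - 1 := by
    convert hmod using 1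
    push_cast
    rw [hn]
    ring
  unfold dbar at h4 ⊢
  split_ifs at h4 ⊢
  · obtain ⟨c, hc⟩ := h5
    obtain ⟨e, he⟩ := h4
    have hd0 : (d : ℤ) ≠ 0 := Nat.cast_ne_zero.2 (NeZero.ne d)
    have h6 : 3 * c = 2 * e := by
      apply mul_left_cancel₀ hd0
      push_cast at he
      linear_combination he - 3 * hc
    refine ⟨e - c, ?_⟩
    push_cast
    linear_combination hc + d * h6
  · exact h5

end Determinant

/-! ### Maximality of `M`, and reduction of `F` modulo `3`. -/

section GroupM

variable {d D : ℕ} [NeZero d] {z : ZMod d → ℂ}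

theorem IsMaximalAbelianIn.mem {G : Type*} [Group G] {M H : Subgroup G}
    (h : IsMaximalAbelianIn M H) {g : G} (hg : g ∈ H) (hgM : ∀ a ∈ M, g * a = a * g) : g ∈ M := by
  have hcomm : ∀ x ∈ insert g (M : Set G), ∀ y ∈ insert g (M : Set G), x * y = y * x := by
    rintro x (rfl | hx) y (rfl | hy)
    · rfl
    · exact hgM y hy
    · exact (hgM x hx).symm
    · exact h.prop.2 x hx y hy
  refine h.le_of_ge (y := Subgroup.closure (insert g (M : Set G))) ⟨?_, ?_⟩ ?_
    (Subgroup.subset_closure (Set.mem_insert _ _))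
  · rw [Subgroup.closure_le]
    exact Set.insert_subset hg h.prop.1
  · intro a ha b hb
    induction ha, hb using Subgroup.closure_induction₂ with
    | mem x y hx hy => exact hcomm x hx y hy
    | one_left x _ => rw [one_mul, mul_one]
    | one_right x _ => rw [one_mul, mul_one]
    | mul_left x y w _ _ _ h1 h2 => exact Commute.mul_left h1 h2
    | mul_right y w x _ _ _ h1 h2 => exact Commute.mul_right h1 h2
    | inv_left x y _ _ h => exact Commute.inv_left h
    | inv_right x y _ _ h => exact Commute.inv_right h
  · exact fun x hx => Subgroup.subset_closure (Set.mem_insert_of_mem _ hx)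

theorem symmetryGroup_le_groupM : symmetryGroup d z ≤ groupM d D z := fun _ hG =>
  ⟨1, one_mem _, fun p => Subtype.ext (hG p).symm⟩

/-- If the canonical symmetry is trivial modulo `3` then so is its image. -/
theorem three_dvd_sub_one_of_map_eq_one {N : ℕ} [NeZero N] {O : Type*} [CommRing O] [CharZero O]
    [IsDomain O] {F : GL (Fin 2) (ZMod N)} {v : O}
    {j : Algebra.adjoin (ZMod N) {F.val} →+* O ⧸ Ideal.span {(N : O)}}
    (hj : j ⟨F.val, Algebra.self_mem_adjoin_singleton _ _⟩ = Ideal.Quotient.mk _ v) (h3 : 3 ∣ N)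
    (hF : Matrix.GeneralLinearGroup.map (n := Fin 2) (ZMod.castHom h3 (ZMod 3)) F = 1) :
    (3 : O) ∣ v - 1 := by
  obtain ⟨m, hm⟩ := id h3
  have hm0 : (m : O) ≠ 0 := by
    rw [Nat.cast_ne_zero]
    rintro rfl
    exact NeZero.ne N hm
  have hx : ∀ x : ZMod N, ZMod.castHom h3 (ZMod 3) x = 0 → (m : ℤ) • x = 0 := by
    intro x hx
    obtain ⟨n, rfl⟩ := ZMod.intCast_surjective x
    rw [map_intCast, ZMod.intCast_zmod_eq_zero_iff_dvd] at hx
    obtain ⟨c, rfl⟩ := hx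
    rw [zsmul_eq_mul, ← Int.cast_mul, ZMod.intCast_zmod_eq_zero_iff_dvd, hm]
    exact ⟨c, by push_cast; ring⟩
  -- Applying `j` to `m (F - 1) = 0` gives `3 m ∣ m (v - 1)` in the domain `O`, where `m` cancels.
  have hz : (m : ℤ) • ((⟨F.val, Algebra.self_mem_adjoin_singleton _ _⟩ :
      Algebra.adjoin (ZMod N) {F.val}) - 1) = 0 := by
    apply Subtype.ext
    change (m : ℤ) • (F.val - 1) = 0
    ext i k
    rw [Matrix.smul_apply]
    refine hx _ ?_
    rw [Matrix.sub_apply, map_sub, sub_eq_zero]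
    have h1 : ZMod.castHom h3 (ZMod 3) (F.val i k) = (1 : Matrix (Fin 2) (Fin 2) (ZMod 3)) i k :=
      congrArg (fun G : GL (Fin 2) (ZMod 3) => G.val i k) hF
    rw [h1, Matrix.one_apply, Matrix.one_apply]
    split_ifs
    · exact (map_one _).symm
    · exact (map_zero _).symm
  have h2 := congrArg j hz
  rw [map_zero, map_zsmul, map_sub, map_one, hj, ← map_one (Ideal.Quotient.mk _), ← map_sub,
    ← map_zsmul, Ideal.Quotient.eq_zero_iff_mem, Ideal.mem_span_singleton] at h2
  obtain ⟨c, hc⟩ := h2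
  refine ⟨c, mul_left_cancel₀ hm0 ?_⟩
  rw [hm] at hc
  push_cast [zsmul_eq_mul] at hc
  linear_combination hc

end GroupM

/-! ### The equation `(d - 3) (d + 1) = f² D` at the prime `3`. -/

section Arithmetic

variable {d D : ℕ} {f : ℤ}

/-- `(d - 3) (d + 1)` lies strictly between `(d - 2)²` and `(d - 1)²`. -/
theorem ne_one_of_isSquarefreePart (hd : 4 ≤ d) (h : IsSquarefreePart d D) : D ≠ 1 := by
  rintro rfl
  obtain ⟨-, f, hf⟩ := h
  push_cast at hf
  have hd' : (4 : ℤ) ≤ d := by exact_mod_cast hd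
  have h0 : (0 : ℤ) ≤ f := Nat.cast_nonneg f
  have h1 : (f : ℤ) < d - 1 := by nlinarith
  have h2 : (d : ℤ) - 2 < f := by nlinarith
  omega

theorem not_nine_dvd_of_squarefree (hsq : Squarefree D) : ¬ 9 ∣ D := fun h =>
  absurd (hsq 3 h) (by norm_num)

/-- Here `d + 1` and `D` are prime to `3`, so `3` divides `d - 3` to the same power as `f²`, hence
at least twice. -/
theorem three_dvd_of_not_dvd (hf : ((d : ℤ) - 3) * ((d : ℤ) + 1) = f ^ 2 * D) (h3 : 3 ∣ d)
    (hD : ¬ 3 ∣ D) : 3 ∣ f ∧ d % 9 = 3 := by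
  obtain ⟨e, rfl⟩ := h3
  have hp : Prime (3 : ℤ) := Int.prime_three
  have h1 : (3 : ℤ) ∣ f := by
    have : (3 : ℤ) ∣ f ^ 2 * D := ⟨(e - 1) * (3 * e + 1), by rw [← hf]; push_cast; ring⟩
    rcases hp.dvd_or_dvd this with h | h
    · exact hp.dvd_of_dvd_pow h
    · exact absurd (by exact_mod_cast h) hD
  refine ⟨h1, ?_⟩
  obtain ⟨g, rfl⟩ := h1
  have h2 : (3 : ℤ) ∣ e - 1 := by
    refine ⟨g ^ 2 * D - e * (e - 1), ?_⟩
    push_cast at hf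
    linarith [hf]
  omega

theorem three_dvd_of_modEq (hsq : Squarefree D)
    (hf : ((d : ℤ) - 3) * ((d : ℤ) + 1) = f ^ 2 * D) (h27 : d ≡ 3 [MOD 27])
    (hD : 3 ∣ D) : 3 ∣ f := by
  have h9 := not_nine_dvd_of_squarefree hsq
  obtain ⟨D', rfl⟩ := hD
  have hp : Prime (3 : ℤ) := Int.prime_three
  have h27' : (27 : ℤ) ∣ d - 3 := by
    unfold Nat.ModEq at h27
    omega
  obtain ⟨c, hc⟩ := h27'
  have : (3 : ℤ) ∣ f ^ 2 * D' := by
    refine ⟨3 * c * (d + 1), ?_⟩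
    rw [hc] at hf
    push_cast at hf
    linarith [hf]
  rcases hp.dvd_or_dvd this with h | h
  · exact hp.dvd_of_dvd_pow h
  · omega

/-- Since `d + 1` is prime to `3` and `D` contains exactly one factor `3`, for `d ≠ 3` the exponent
of `3` in `d - 3` is odd; being at least `2`, it is at least `3`. -/
theorem modEq_of_three_dvd (hsq : Squarefree D)
    (hf : ((d : ℤ) - 3) * ((d : ℤ) + 1) = f ^ 2 * D) (h9 : (9 : ℤ) ∣ d - 3) (hD : 3 ∣ D) :
    d ≡ 3 [MOD 27] := by
  have hD9 := not_nine_dvd_of_squarefree hsq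
  obtain ⟨D', rfl⟩ := hD
  have hp : Prime (3 : ℤ) := Int.prime_three
  obtain ⟨c, hc⟩ := h9
  rw [hc] at hf
  have h1 : (3 : ℤ) ∣ f := by
    have : (3 : ℤ) ∣ f ^ 2 * D' := by
      refine ⟨c * (d + 1), ?_⟩
      push_cast at hf
      linarith [hf]
    rcases hp.dvd_or_dvd this with h | h
    · exact hp.dvd_of_dvd_pow h
    · omega
  obtain ⟨g, rfl⟩ := h1
  have h2 : (3 : ℤ) ∣ c * (d + 1) := by
    refine ⟨g ^ 2 * D', ?_⟩
    push_cast at hf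
    linarith [hf]
  unfold Nat.ModEq
  rcases hp.dvd_or_dvd h2 with h | h <;> omega

theorem nine_dvd_sub_three (h3 : (3 : ℤ) ∣ d) (h : (9 : ℤ) ∣ (d - 3) * (d + 1)) :
    (9 : ℤ) ∣ d - 3 := by
  obtain ⟨e, he⟩ := h3
  rw [he] at h ⊢
  obtain ⟨c, hc⟩ := h
  exact ⟨c - e * (e - 1), by linarith [hc]⟩

theorem three_dvd_dbar_iff : 3 ∣ dbar d ↔ 3 ∣ d := by
  unfold dbar
  split_ifs <;> omega

theorem dbar_div_cases (hd : 4 ≤ d) : dbar d / d = 1 ∨ dbar d / d = 2 := by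
  unfold dbar
  split_ifs
  · right
    exact Nat.mul_div_cancel _ (by omega)
  · left
    exact Nat.div_self (by omega)

theorem exists_dbar_eq (h9 : d % 9 = 3) : ∃ (m : ℕ) (k l : ℤ), dbar d = 3 * m ∧ m ≠ 0 ∧
    3 * k + m * l = 1 := by
  obtain ⟨e, he⟩ : ∃ e, d = 9 * e + 3 := ⟨d / 9, by omega⟩
  unfold dbar
  split_ifs
  · exact ⟨2 * (3 * e + 1), 2 * e + 1, -1, by omega, by omega, by push_cast; ring⟩
  · exact ⟨3 * e + 1, -e, 1, by omega, by omega, by push_cast; ring⟩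

end Arithmetic

/-! ### Assembly: type `a` and type `z`. -/

section Main

variable {d D : ℕ} [NeZero d] {z : ZMod d → ℂ} {F : GLd d}

theorem mul_eq_mul_of_mem_groupM
    (hM : IsMaximalAbelianIn (groupM d D z)
      (Subgroup.centralizer (symmetryGroup d z : Set (GLd d))))
    (hF : F ∈ symmetryGroup d z) {G : GLd d} (hG : G ∈ groupM d D z) :
    G.val * F.val = F.val * G.val :=
  (congrArg Units.val (Subgroup.mem_centralizer_iff.1 (hM.prop.1 hG) F hF)).symm

/-- Such a `G` commutes with all of `M` because `F` does, in particular with `S ≤ M`; maximality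
absorbs it. -/
theorem mem_groupM_of_mem_adjoin
    (hM : IsMaximalAbelianIn (groupM d D z)
      (Subgroup.centralizer (symmetryGroup d z : Set (GLd d))))
    (hF : F ∈ symmetryGroup d z) (htr : F.val.trace = -1) (hdet : F.val.det = 1) {G : GLd d}
    (hG : G.val ∈ Algebra.adjoin (ZMod (dbar d)) {F.val}) : G ∈ groupM d D z := by
  have hcomm : ∀ H ∈ groupM d D z, G * H = H * G := by
    intro H hH
    obtain ⟨x, y, hxy⟩ := (mem_adjoin_singleton_iff htr hdet).1 hG
    apply Units.ext
    rw [Units.val_mul, Units.val_mul, hxy, add_mul, mul_add, smul_mul_assoc, mul_smul_comm,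
      smul_mul_assoc, mul_smul_comm, one_mul, mul_one, mul_eq_mul_of_mem_groupM hM hF hH]
  exact hM.mem (Subgroup.mem_centralizer_iff.2 fun s hs =>
    (hcomm s (symmetryGroup_le_groupM hs)).symm) hcomm

theorem IsUnitD.mul_conjO_eq_one (hsq : Squarefree D) (h1 : D ≠ 1) {u : (𝓞 (fieldK D))ˣ}
    (h : IsUnitD D u) : (u : 𝓞 (fieldK D)) * conjO hsq h1 u = 1 := by
  obtain ⟨uf, -, k, hk, rfl⟩ := h
  exact SIC.mul_conjO_eq_one hsq h1 hk.1.2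

theorem IsAlgebraicFiducial.exists_unit (hsq : Squarefree D) (h1 : D ≠ 1)
    (h : IsAlgebraicFiducial d D z F) : ∃ u : 𝓞 (fieldK D), u * conjO hsq h1 u = 1 ∧
      u + conjO hsq h1 u = ((d - 1 : ℤ) : 𝓞 (fieldK D)) ∧
      ∃ j : Algebra.adjoin (ZMod (dbar d)) {F.val} →+* quotO d D,
        j ⟨F.val, Algebra.self_mem_adjoin_singleton _ _⟩ =
          Ideal.Quotient.mk _ (u ^ (dbar d / d)) ∧
        ∃ jhat : groupM d D z ≃* (quotO d D)ˣ,
          ∀ (G : groupM d D z) (hG : (G : GLd d).val ∈ Algebra.adjoin (ZMod (dbar d)) {F.val}),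
            ((jhat G : (quotO d D)ˣ) : quotO d D) = j ⟨(G : GLd d).val, hG⟩ := by
  obtain ⟨uD, r, huD, hr, j, hj, jhat, hjhat⟩ := h
  refine ⟨(uD ^ r : (𝓞 (fieldK D))ˣ), ?_, add_conjO_of_hasRationalPart hsq h1 hr, j, ?_, jhat,
    hjhat⟩
  · rw [Units.val_pow_eq_pow_val, map_pow, ← mul_pow, huD.mul_conjO_eq_one hsq h1, one_pow]
  · rw [hj, mul_comm, pow_mul, Units.val_pow_eq_pow_val]

/-- In the split, inert and ramified cases, an algebraic fiducial is of type `a`, and `M₃` is the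
unit group of `𝓞_K / 3`. -/
theorem isTypeAWith_of_units_mulEquiv (hd : 4 ≤ d) (hsq : Squarefree D) (h1 : D ≠ 1)
    (hM : IsMaximalAbelianIn (groupM d D z)
      (Subgroup.centralizer (symmetryGroup d z : Set (GLd d))))
    (hF : IsCanonicalSymmetry d z F) (halg : IsAlgebraicFiducial d D z F)
    {f : ℤ} (hf : ((d : ℤ) - 3) * ((d : ℤ) + 1) = f ^ 2 * D) (hf3 : 3 ∣ f) (h9 : d % 9 = 3)
    {A : Type} [Group A]
    (hA : Nonempty ((QuadraticAlgebra (ZMod 3) (D : ZMod 3) 0)ˣ ≃* A)) :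
    IsTypeAWith d D z F A := by
  obtain ⟨u, hu, hut, j, hj, jhat, hjhat⟩ := halg.exists_unit hsq h1
  have hdet := hF.det_eq_one hd
  have h3d : 3 ∣ d := by omega
  have h3 : 3 ∣ dbar d := three_dvd_dbar_iff.2 h3d
  obtain ⟨m, k, l, hN, hm, hkl⟩ := exists_dbar_eq h9
  have hv : u ^ (dbar d / d) * conjO hsq h1 (u ^ (dbar d / d)) = 1 := by
    rw [map_pow, ← mul_pow, hu, one_pow]
  obtain ⟨t, ht⟩ := exists_add_conjO hsq h1 (u ^ (dbar d / d))
  have hv3 : (3 : 𝓞 (fieldK D)) ∣ u ^ (dbar d / d) - 1 :=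
    (three_dvd_sub_one hsq h1 hu hut hf hf3 h3d).trans (sub_one_dvd_pow_sub_one _ _)
  have hMunit : ∀ G : GLd d, G.val ∈ Algebra.adjoin (ZMod (dbar d)) {F.val} → G ∈ groupM d D z :=
    fun _ => mem_groupM_of_mem_adjoin hM hF.mem hF.trace hdet
  have hF3 : F ^ 3 = 1 := hF.order ▸ pow_orderOf_eq_one F
  refine ⟨fun hZ => ?_, h3, ?_⟩
  · obtain ⟨P, hP⟩ := isTypeZ_iff.1 hZ
    exact map_ne_one_of_conj h3 hP
      (map_eq_one_of_three_dvd hF3 hMunit hj hjhat hN hm hkl h3 hv3)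
  · obtain ⟨e1⟩ := nonempty_map_mulEquiv (exists_add_conjO hsq h1) (exists_mul_conjO hsq h1) hv ht
      hF.trace hdet (fun _ => mul_eq_mul_of_mem_groupM hM hF.mem) hMunit hj hjhat hN hm hkl h3
    obtain ⟨e2⟩ := nonempty_quotient_three_ringEquiv hsq h1
    obtain ⟨e3⟩ := hA
    exact ⟨e1.trans ((Units.mapEquiv e2.toMulEquiv).symm.trans e3)⟩

theorem isTypeZ_of_not (hd : 4 ≤ d) (hsq : Squarefree D) (h1 : D ≠ 1)
    (hF : IsCanonicalSymmetry d z F) (halg : IsAlgebraicFiducial d D z F)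
    {f : ℤ} (hf : ((d : ℤ) - 3) * ((d : ℤ) + 1) = f ^ 2 * D)
    (h : ¬ (3 ∣ d ∧ D ≡ 1 [MOD 3]) ∧ ¬ (d ≡ 3 [MOD 27] ∧ 3 ∣ D) ∧ ¬ (3 ∣ d ∧ D ≡ 2 [MOD 3])) :
    IsTypeZ d F := by
  have : NeZero (dbar d) := ⟨by have := one_lt_dbar hd; omega⟩
  rw [isTypeZ_iff]
  refine (exists_conj_or_three hF.trace (hF.det_eq_one hd)).resolve_right ?_
  rintro ⟨h3, hF1⟩
  obtain ⟨u, hu, hut, j, hj, -⟩ := halg.exists_unit hsq h1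
  have hv3 := three_dvd_sub_one_of_map_eq_one hj h3 hF1
  have h3d : 3 ∣ d := three_dvd_dbar_iff.1 h3
  have hv : u ^ (dbar d / d) * conjO hsq h1 (u ^ (dbar d / d)) = 1 := by
    rw [map_pow, ← mul_pow, hu, one_pow]
  have h9 : (9 : ℤ) ∣ (d : ℤ) - 3 := by
    -- The trace of `v` minus `2` is `d - 3` for `ι = 1`, and `(d - 1)² - 4 = (d - 3) (d + 1)` for
    -- `ι = 2`.
    rcases dbar_div_cases hd with hι | hι <;> rw [hι] at hv hv3
    · rw [pow_one] at hv hv3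
      have := nine_dvd_trace_sub_two (exists_mul_conjO hsq h1) hv hut hv3
      omega
    · have ht : u ^ 2 + conjO hsq h1 (u ^ 2) = ((((d - 1) ^ 2 - 2 : ℤ)) : 𝓞 (fieldK D)) := by
        rw [map_pow]
        push_cast at hut ⊢
        linear_combination (u + conjO hsq h1 u + d - 1) * hut - 2 * hu
      have := nine_dvd_trace_sub_two (exists_mul_conjO hsq h1) hv ht hv3
      refine nine_dvd_sub_three (by exact_mod_cast h3d) ?_
      convert this using 1
      ring
  have hD : 3 ∣ D := by
    obtain ⟨ha, -, hb⟩ := h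
    by_contra hD
    unfold Nat.ModEq at ha hb
    omega
  exact h.2.1 ⟨modEq_of_three_dvd hsq hf h9 hD, hD⟩

end Main
end SIC

theorem mainTheorem3 (d D : ℕ) [NeZero d] (hd : 4 ≤ d) (hD : SIC.IsSquarefreePart d D)
    (z : ZMod d → ℂ) (hz : SIC.IsStronglyCentred d D z)
    (hM : SIC.IsMaximalAbelianIn (SIC.groupM d D z)
      (Subgroup.centralizer (SIC.symmetryGroup d z : Set (SIC.GLd d))))
    (F : SIC.GLd d) (hF : SIC.IsCanonicalSymmetry d z F)
    (halg : SIC.IsAlgebraicFiducial d D z F) :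
    (3 ∣ d ∧ D ≡ 1 [MOD 3] → SIC.IsTypeA4 d D z F) ∧
    (d ≡ 3 [MOD 27] ∧ 3 ∣ D → SIC.IsTypeA6 d D z F) ∧
    (3 ∣ d ∧ D ≡ 2 [MOD 3] → SIC.IsTypeA8 d D z F) ∧
    (¬ (3 ∣ d ∧ D ≡ 1 [MOD 3]) ∧ ¬ (d ≡ 3 [MOD 27] ∧ 3 ∣ D) ∧ ¬ (3 ∣ d ∧ D ≡ 2 [MOD 3]) →
      SIC.IsTypeZ d F) := by
  have h1 := SIC.ne_one_of_isSquarefreePart hd hD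
  obtain ⟨hsq, f, hf⟩ := hD
  refine ⟨?_, ?_, ?_, SIC.isTypeZ_of_not hd hsq h1 hF halg hf⟩
  · rintro ⟨h3, hD⟩
    obtain ⟨hf3, h9⟩ := SIC.three_dvd_of_not_dvd hf h3 (by unfold Nat.ModEq at hD; omega)
    refine SIC.isTypeAWith_of_units_mulEquiv hd hsq h1 hM hF halg hf hf3 h9 ?_
    rw [(ZMod.natCast_eq_natCast_iff D 1 3).2 hD, Nat.cast_one]
    exact SIC.nonempty_units_mulEquiv_split
  · rintro ⟨h27, hD⟩
    refine SIC.isTypeAWith_of_units_mulEquiv hd hsq h1 hM hF halg hf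
      (SIC.three_dvd_of_modEq hsq hf h27 hD) (by unfold Nat.ModEq at h27; omega) ?_
    rw [(ZMod.natCast_eq_zero_iff D 3).2 hD]
    exact SIC.nonempty_units_mulEquiv_ramified
  · rintro ⟨h3, hD⟩
    obtain ⟨hf3, h9⟩ := SIC.three_dvd_of_not_dvd hf h3 (by unfold Nat.ModEq at hD; omega)
    refine SIC.isTypeAWith_of_units_mulEquiv hd hsq h1 hM hF halg hf hf3 h9 ?_
    rw [(ZMod.natCast_eq_natCast_iff D 2 3).2 hD]
    exact SIC.nonempty_units_mulEquiv_inert
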